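/- Let $a>0$, let $q:[-a,a]\to\mathbb{C}$ be continuous, let $h\in\mathbb{C}$, and let $K(x,t)=K(x,t;h)$ be a complex-valued function on $D=\{(x,t):|t|\le|x|\le a\}$. For continuous $K$ write \[ T_Ku(x)=u(x)+\int_{-x}^{x}K(x,t)\,u(t)\,dt,\qquad x\in[-a,a]. \] Consider the following property. (M) $K$ is continuous on $D$ and, for every $\omega\in\mathbb{C}$, $T_K$ maps each classical solution $v$ on $[-a,a]$ of $v''+\omega^2v=0$ to a classical solution $u$ on $[-a,a]$ of $u''-q(x)u+\omega^2u=0$ with $u(0)=v(0)$ and $u'(0)=v'(0)+h\,v(0)$. Let $H(u,v):=K(u+v,u-v)$ on $\Omega=\{(u,v):uv\ge 0,\ |u+v|\le a\}$. Then the following are equivalent: 1. $K$ has property (M); 2. $K$ has property (M) and $T_K$ is a transmutation operator on $C[-a,a]$ for the pair $-\frac{d^2}{dx^2}+q$, $-\frac{d^2}{dx^2}$; that is, $T_K$ is an invertible linear operator on $C[-a,a]$ (uniform topology), continuous together with its inverse, it maps $C^2[-a,a]$ into itself, and $\left(-\frac{d^2}{dx^2}+q\right)T_Ku=T_K\left(-u''\right)$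 for all $u\in C^2[-a,a]$; 3. $H$ is a classical solution of the Goursat problem \[ \frac{\partial^2H}{\partial u\,\partial v}=q(u+v)H,\qquad H(u,0)=\frac h2+\frac12\int_0^uq(s)\,ds,\qquad H(0,v)=\frac h2\qquad(u,v\in[-a,a]), \] that is, $H$ is continuous on $\Omega$ and $C^1$ in the interior of $\Omega$, the boundary conditions hold, and in the interior both mixed second derivatives $\partial_u\partial_vH$ and $\partial_v\partial_uH$ exist and equal $q(u+v)H$. If moreover $q\in C^1[-a,a]$, then these conditions are equivalent to: $K$ is a classical solution of the Goursat problem \[ \left(\frac{\partial^2}{\partial x^2}-q(x)\right)K=\frac{\partial^2}{\partial t^2}K,\qquad K(x,x)=\frac h2+\frac12\int_0^xq(s)\,ds,\qquad K(x,-x)=\frac h2\qquad(x\in[-a,a]), \] that is, $K$ is continuous on $D$ and $C^2$ in the interior of $D$, the equation holds in the interior, and the boundary conditions hold. -/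

import Mathlib

open Set

noncomputable section

namespace Transmutation

/-- The closed set of pairs `(x, t)` with `|t| ≤ |x| ≤ a`: exactly the arguments at which
`u(x) + ∫_{-x}^{x} K(x,t) u(t) dt`, for `-a ≤ x ≤ a`, evaluates the kernel `K`. -/
def kernelDomain (a : ℝ) : Set (ℝ × ℝ) := {p | |p.2| ≤ |p.1| ∧ |p.1| ≤ a}

/-- The interior of `kernelDomain a`. -/
def kernelInterior (a : ℝ) : Set (ℝ × ℝ) := {p | |p.2| < |p.1| ∧ |p.1| < a}

/-- The same set in the characteristic coordinates `x = u + v`, `t = u - v`. -/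
def charDomain (a : ℝ) : Set (ℝ × ℝ) := {p | 0 ≤ p.1 * p.2 ∧ |p.1 + p.2| ≤ a}

/-- The interior of `charDomain a`. -/
def charInterior (a : ℝ) : Set (ℝ × ℝ) := {p | 0 < p.1 * p.2 ∧ |p.1 + p.2| < a}

/-- The Volterra operator `u ↦ u(x) + ∫_{-x}^{x} K(x,t) u(t) dt`
(oriented integral, so that `x < 0` is allowed). -/
def volterra (K : ℝ → ℝ → ℂ) (u : ℝ → ℂ) (x : ℝ) : ℂ :=
  u x + ∫ t in (-x)..x, K x t * u t

/-- `u` is a classical solution of `u'' = p u` on `[-a, a]`, and `u₁` is its derivative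
(derivatives at the end points are one-sided). -/
def IsSolution (a : ℝ) (p : ℝ → ℂ) (u u₁ : ℝ → ℂ) : Prop :=
  ∀ x ∈ Icc (-a) a,
    HasDerivWithinAt u (u₁ x) (Icc (-a) a) x ∧
    HasDerivWithinAt u₁ (p x * u x) (Icc (-a) a) x

/-- `K` is continuous, and the Volterra operator with kernel `K` maps, for every complex `ω`,
each solution `v` of `v'' + ω² v = 0` on `[-a, a]` to a solution `u` of
`u'' - q u + ω² u = 0` on `[-a, a]` with `u(0) = v(0)` and `u'(0) = v'(0) + h v(0)`. -/
def MapsSolutions (a : ℝ) (q : ℝ → ℂ) (h : ℂ) (K : ℝ → ℝ → ℂ) : Prop :=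
  ContinuousOn (Function.uncurry K) (kernelDomain a) ∧
  ∀ (ω : ℂ) (v v₁ : ℝ → ℂ), IsSolution a (fun _ => -ω ^ 2) v v₁ →
    ∃ u₁ : ℝ → ℂ,
      IsSolution a (fun x => q x - ω ^ 2) (volterra K v) u₁ ∧
      volterra K v 0 = v 0 ∧ u₁ 0 = v₁ 0 + h * v 0

/-- For `u, u₂ ∈ C[-a, a]`: the function `u` belongs to `C²[-a, a]`, and `u'' = u₂`. -/
def HasSecondDeriv {a : ℝ} (ha : -a ≤ a) (u u₂ : C(Icc (-a) a, ℂ)) : Prop :=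
  ∃ u₁ : C(Icc (-a) a, ℂ), ∀ x : Icc (-a) a,
    HasDerivWithinAt (IccExtend ha u) (u₁ x) (Icc (-a) a) x ∧
    HasDerivWithinAt (IccExtend ha u₁) (u₂ x) (Icc (-a) a) x

/-- `T`, an invertible linear operator on `C[-a, a]` (uniform topology) continuous together with
its inverse, is a transmutation operator for `A = -d²/dx² + q` and `B = -d²/dx²`: it leaves
`C²[-a, a]` invariant, and `A T = T B` on `C²[-a, a]`. -/
def IsTransmutation {a : ℝ} (ha : -a ≤ a) (q : ℝ → ℂ)
    (T : C(Icc (-a) a, ℂ) ≃L[ℂ] C(Icc (-a) a, ℂ)) : Prop :=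
  ∀ u u₂ : C(Icc (-a) a, ℂ), HasSecondDeriv ha u u₂ →
    ∃ w₂ : C(Icc (-a) a, ℂ), HasSecondDeriv ha (T u) w₂ ∧
      ∀ x : Icc (-a) a, -w₂ x + q x * T u x = T (-u₂) x

/-- The Volterra operator with kernel `K` is a transmutation operator on `C[-a, a]`
for `-d²/dx² + q` and `-d²/dx²`. -/
def VolterraIsTransmutation {a : ℝ} (ha : -a ≤ a) (q : ℝ → ℂ) (K : ℝ → ℝ → ℂ) : Prop :=
  ∃ T : C(Icc (-a) a, ℂ) ≃L[ℂ] C(Icc (-a) a, ℂ),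
    (∀ (u : C(Icc (-a) a, ℂ)) (x : Icc (-a) a), T u x = volterra K (IccExtend ha u) x) ∧
    IsTransmutation ha q T

/-- `H` is a classical solution of the Goursat problem `H_{uv} = q(u+v) H`,
`H(u,0) = h/2 + ½ ∫₀ᵘ q`, `H(0,v) = h/2`: it is continuous on the closed domain and `C¹` inside,
and inside both mixed second derivatives exist and satisfy the equation. -/
structure SolvesCharGoursat (a : ℝ) (q : ℝ → ℂ) (h : ℂ) (H : ℝ → ℝ → ℂ) : Prop where
  continuousOn : ContinuousOn (Function.uncurry H) (charDomain a)
  contDiffOn : ContDiffOn ℝ 1 (Function.uncurry H) (charInterior a)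
  deriv_u_deriv_v : ∀ u v : ℝ, (u, v) ∈ charInterior a →
    HasDerivAt (fun u' => deriv (fun v' => H u' v') v) (q (u + v) * H u v) u
  deriv_v_deriv_u : ∀ u v : ℝ, (u, v) ∈ charInterior a →
    HasDerivAt (fun v' => deriv (fun u' => H u' v') u) (q (u + v) * H u v) v
  on_u_axis : ∀ u ∈ Icc (-a) a, H u 0 = h / 2 + (1 / 2) * ∫ s in (0 : ℝ)..u, q s
  on_v_axis : ∀ v ∈ Icc (-a) a, H 0 v = h / 2

/-- `K` is a classical solution of the Goursat problem `K_{xx} - q(x) K = K_{tt}`,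
`K(x,x) = h/2 + ½ ∫₀ˣ q`, `K(x,-x) = h/2`: it is continuous on the closed domain and `C²` inside,
where it satisfies the equation. -/
structure SolvesWaveGoursat (a : ℝ) (q : ℝ → ℂ) (h : ℂ) (K : ℝ → ℝ → ℂ) : Prop where
  continuousOn : ContinuousOn (Function.uncurry K) (kernelDomain a)
  contDiffOn : ContDiffOn ℝ 2 (Function.uncurry K) (kernelInterior a)
  equation : ∀ x t : ℝ, (x, t) ∈ kernelInterior a →
    iteratedDeriv 2 (fun x' => K x' t) x - q x * K x t = iteratedDeriv 2 (fun t' => K x t') t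
  on_diagonal : ∀ x ∈ Icc (-a) a, K x x = h / 2 + (1 / 2) * ∫ s in (0 : ℝ)..x, q s
  on_antidiagonal : ∀ x ∈ Icc (-a) a, K x (-x) = h / 2

end Transmutation

end

noncomputable section

namespace Transmutation

open MeasureTheory intervalIntegral Filter Topology Function

/-! Everything passes through the Goursat problem integrated once in each characteristic variable:
K(u+v,u-v) = G(u,v), where G(u,v) = h/2 + ½∫₀ᵘ q + ∫₀ᵘ∫₀ᵛ q(s+r) K(s+r,s-r) dr ds
(`SolvesIntegralEquation`). It involves no derivatives of K, so continuity of q and K suffices.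

The central identity is `integral_goursatIntegral_mul`. For every continuous K, whether or not it
solves anything, pairing G with F' over [-x,x] gives (h/2)(F(x)-F(-x)) + D(F), where D is a Duhamel
integral containing T_K itself (`duhamelSub`). Differentiating f + (h/2)(F(x)-F(-x)) + D(F), where
F' = f, twice gives q·T_K f plus the same expression with f'' and f' in place of f and F. If K
solves the integral equation, the expression is T_K f, so (T_K f)'' = q T_K f + T_K f''. This yields
(M) and the intertwining relation; T_K is invertible because a Volterra integral operator contracts
a suitably weighted sup norm.

Conversely, assume (M) and take f = exp(κ·). Both T_K f and the Duhamel expression solve w'' = κ²w +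
q T_K f with the same Cauchy data at 0, so they agree. Thus K(x,·) and G have equal integrals
against all exponentials, and Parseval gives K = G.

The characteristic Goursat problem and the integral equation are exchanged by differentiation and by
integration over rectangles. If q is C¹, substituting G for K in the first partials of G shows that
G is C² inside; the wave form is then a linear change of variables. -/

/-! ### Calculus of parametric integrals -/

theorem hasDerivAt_integral_of_continuous {F F' : ℝ → ℝ → ℂ} (hF : Continuous (uncurry F))
    (hF' : Continuous (uncurry F')) (hd : ∀ x y, HasDerivAt (fun x => F x y) (F' x y) x)
    (b c x : ℝ) :
    HasDerivAt (fun x => ∫ y in b..c, F x y) (∫ y in b..c, F' x y) x := by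
  obtain ⟨C, hC⟩ := ((isCompact_closedBall x 1).prod (isCompact_uIcc (a := b) (b := c))).exists_bound_of_continuousOn
    hF'.continuousOn
  have hs : ∀ x, Continuous (F x) := fun x => hF.comp (by fun_prop : Continuous fun y => (x, y))
  have hs' : ∀ x, Continuous (F' x) := fun x => hF'.comp (by fun_prop : Continuous fun y => (x, y))
  refine (intervalIntegral.hasDerivAt_integral_of_dominated_loc_of_deriv_le
    (bound := fun _ => C) (Metric.closedBall_mem_nhds x one_pos)
    (Eventually.of_forall fun x => (hs x).aestronglyMeasurable) ((hs x).intervalIntegrable _ _)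
    (hs' x).aestronglyMeasurable ?_ intervalIntegrable_const ?_).2
  · exact Eventually.of_forall fun y hy z hz => hC (z, y) ⟨hz, uIoc_subset_uIcc hy⟩
  · exact Eventually.of_forall fun y _ z _ => hd z y

theorem hasStrictFDerivAt_of_continuous_partials {f f₁ f₂ : ℝ → ℝ → ℂ}
    (h₁ : Continuous (uncurry f₁)) (h₂ : Continuous (uncurry f₂))
    (hd₁ : ∀ x y, HasDerivAt (fun x => f x y) (f₁ x y) x)
    (hd₂ : ∀ x y, HasDerivAt (fun y => f x y) (f₂ x y) y) (p : ℝ × ℝ) :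
    HasStrictFDerivAt (uncurry f)
      ((ContinuousLinearMap.toSpanSingleton ℝ (f₁ p.1 p.2)).coprod
        (ContinuousLinearMap.toSpanSingleton ℝ (f₂ p.1 p.2))) p := by
  refine hasStrictFDerivAt_uncurry_coprod (𝕜 := ℝ)
    (f₁ := fun x y => ContinuousLinearMap.toSpanSingleton ℝ (f₁ x y))
    (f₂ := fun x y => ContinuousLinearMap.toSpanSingleton ℝ (f₂ x y)) ?_ ?_ ?_ ?_
  · exact Eventually.of_forall fun v => (hd₁ v.1 v.2).hasFDerivAt
  · exact Eventually.of_forall fun v => (hd₂ v.1 v.2).hasFDerivAt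
  · exact ((ContinuousLinearMap.toSpanSingletonCLE (𝕜 := ℝ) (E := ℂ)).continuous.comp h₁).continuousAt
  · exact ((ContinuousLinearMap.toSpanSingletonCLE (𝕜 := ℝ) (E := ℂ)).continuous.comp h₂).continuousAt

theorem contDiff_one_of_continuous_partials {f f₁ f₂ : ℝ → ℝ → ℂ}
    (h₁ : Continuous (uncurry f₁)) (h₂ : Continuous (uncurry f₂))
    (hd₁ : ∀ x y, HasDerivAt (fun x => f x y) (f₁ x y) x)
    (hd₂ : ∀ x y, HasDerivAt (fun y => f x y) (f₂ x y) y) :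
    ContDiff ℝ 1 (uncurry f) := by
  have h := hasStrictFDerivAt_of_continuous_partials h₁ h₂ hd₁ hd₂
  rw [contDiff_one_iff_hasFDerivAt]
  refine ⟨_, ?_, fun p => (h p).hasFDerivAt⟩
  have e₁ := (ContinuousLinearMap.toSpanSingletonCLE (𝕜 := ℝ) (E := ℂ)).continuous.comp h₁
  have e₂ := (ContinuousLinearMap.toSpanSingletonCLE (𝕜 := ℝ) (E := ℂ)).continuous.comp h₂
  exact (e₁.clm_comp (continuous_const (y := ContinuousLinearMap.fst ℝ ℝ ℝ))).add
    (e₂.clm_comp (continuous_const (y := ContinuousLinearMap.snd ℝ ℝ ℝ)))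

theorem continuous_primitive {F : ℝ → ℝ → ℂ} (hF : Continuous (uncurry F)) :
    Continuous (uncurry fun x z => ∫ y in (0 : ℝ)..z, F x y) :=
  intervalIntegral.continuous_parametric_intervalIntegral_of_continuous
    (f := fun (p : ℝ × ℝ) y => F p.1 y) (s := Prod.snd)
    (hF.comp (by fun_prop : Continuous fun q : (ℝ × ℝ) × ℝ => (q.1.1, q.2))) continuous_snd

theorem hasDerivAt_primitive {f : ℝ → ℂ} (hf : Continuous f) (x : ℝ) :
    HasDerivAt (fun x => ∫ y in (0 : ℝ)..x, f y) (f x) x :=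
  intervalIntegral.integral_hasDerivAt_right (hf.intervalIntegrable _ _)
    hf.aestronglyMeasurable.stronglyMeasurableAtFilter hf.continuousAt

theorem continuous_left {F : ℝ → ℝ → ℂ} (hF : Continuous (uncurry F)) (y : ℝ) :
    Continuous fun x => F x y := hF.comp (by fun_prop : Continuous fun x => (x, y))

theorem continuous_right {F : ℝ → ℝ → ℂ} (hF : Continuous (uncurry F)) (x : ℝ) :
    Continuous (F x) := hF.comp (by fun_prop : Continuous fun y => (x, y))

/-- The Leibniz rule for `∫₀ˣ F(x,y) dy`. -/
theorem hasDerivAt_integral_diag {F F' : ℝ → ℝ → ℂ} (hF : Continuous (uncurry F))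
    (hF' : Continuous (uncurry F')) (hd : ∀ x y, HasDerivAt (fun x => F x y) (F' x y) x) (x : ℝ) :
    HasDerivAt (fun x => ∫ y in (0 : ℝ)..x, F x y) (F x x + ∫ y in (0 : ℝ)..x, F' x y) x := by
  -- The upper limit and the parameter are first treated as independent variables; the chain rule
  -- along the diagonal then gives both terms.
  have h := (hasStrictFDerivAt_of_continuous_partials
    (f := fun x z => ∫ y in (0 : ℝ)..z, F x y) (continuous_primitive hF') hF
    (fun x z => hasDerivAt_integral_of_continuous hF hF' hd 0 z x)
    (fun x z => hasDerivAt_primitive (continuous_right hF x) z) (x, x)).hasFDerivAt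
  have h2 : HasDerivAt (fun x : ℝ => (x, x)) ((1 : ℝ), (1 : ℝ)) x :=
    (hasDerivAt_id x).prodMk (hasDerivAt_id x)
  have h3 := h.comp_hasDerivAt (f := fun x : ℝ => (x, x)) x h2
  simp only [ContinuousLinearMap.coprod_apply, ContinuousLinearMap.toSpanSingleton_apply, one_smul] at h3
  rw [add_comm]
  exact h3

theorem eq_of_hasDerivAt_eq {f g f' : ℝ → ℂ} (hf : ∀ x, HasDerivAt f (f' x) x)
    (hg : ∀ x, HasDerivAt g (f' x) x) (h0 : f 0 = g 0) : f = g := by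
  have hd : ∀ x, HasDerivAt (fun x => f x - g x) 0 x := fun x => by
    simpa using (hf x).fun_sub (hg x)
  funext x
  have := is_const_of_deriv_eq_zero (fun x => (hd x).differentiableAt) (fun x => (hd x).deriv) x 0
  simpa [h0, sub_eq_zero] using this

/-- Interchanging the order of integration over the triangle with vertices `(0,0)`, `(0,x)`, `(x,x)`. -/
theorem integral_triangle_swap {f : ℝ → ℝ → ℂ} (hf : Continuous (uncurry f)) (x : ℝ) :
    (∫ s in (0 : ℝ)..x, ∫ y in s..x, f s y) = ∫ y in (0 : ℝ)..x, ∫ s in (0 : ℝ)..y, f s y := by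
  have hA := continuous_primitive hf
  have hfs := fun s => continuous_right hf s
  have e : ∀ s x, (∫ y in s..x, f s y) = (∫ y in (0 : ℝ)..x, f s y) - ∫ y in (0 : ℝ)..s, f s y :=
    fun s x => (integral_interval_sub_left ((hfs s).intervalIntegrable _ _)
      ((hfs s).intervalIntegrable _ _)).symm
  have hg : Continuous (uncurry fun x s => ∫ y in s..x, f s y) := by
    simp only [e]
    exact (hA.comp (by fun_prop : Continuous fun p : ℝ × ℝ => (p.2, p.1))).sub
      (hA.comp (by fun_prop : Continuous fun p : ℝ × ℝ => (p.2, p.2)))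
  have hsw : Continuous (uncurry fun x s => f s x) :=
    hf.comp (by fun_prop : Continuous fun p : ℝ × ℝ => (p.2, p.1))
  -- Both sides vanish at x = 0 and have derivative ∫₀ˣ f(s,x) ds; on the left the boundary term is
  -- an integral over [x,x].
  refine congrFun (eq_of_hasDerivAt_eq (f' := fun x => ∫ s in (0 : ℝ)..x, f s x)
    (f := fun x => ∫ s in (0 : ℝ)..x, ∫ y in s..x, f s y)
    (g := fun x => ∫ y in (0 : ℝ)..x, ∫ s in (0 : ℝ)..y, f s y) (fun x => ?_) (fun x => ?_) (by simp)) x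
  · have := hasDerivAt_integral_diag hg hsw (fun x s => by
      simp only [e]
      exact (hasDerivAt_primitive (hfs s) x).sub_const _) x
    simpa using this
  · exact hasDerivAt_primitive
      ((continuous_primitive hsw).comp (by fun_prop : Continuous fun p : ℝ => (p, p))) x

theorem continuous_integral_bounds {X : Type*} [TopologicalSpace X] [FirstCountableTopology X]
    {F : X → ℝ → ℂ} {b c : X → ℝ}
    (hF : Continuous (uncurry F)) (hb : Continuous b) (hc : Continuous c) :
    Continuous fun p => ∫ t in b p..c p, F p t := by
  have hFs : ∀ p, Continuous (F p) := fun p => hF.comp (by fun_prop : Continuous fun y => (p, y))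
  have e : ∀ p, (∫ t in b p..c p, F p t) = (∫ t in (0 : ℝ)..c p, F p t) - ∫ t in (0 : ℝ)..b p, F p t :=
    fun p => (integral_interval_sub_left ((hFs p).intervalIntegrable _ _)
      ((hFs p).intervalIntegrable _ _)).symm
  simp only [e]
  exact (continuous_parametric_intervalIntegral_of_continuous hF hc).sub
    (continuous_parametric_intervalIntegral_of_continuous hF hb)

/-- With t = 2s - x the characteristic coordinates of (x,t) are (s, x-s); in the companion form t =
x - 2r they are (x-r, r). -/
theorem integral_symm_eq_left (g : ℝ → ℂ) (x : ℝ) :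
    (∫ t in (-x)..x, g t) = 2 * ∫ s in (0 : ℝ)..x, g (2 * s - x) := by
  rw [integral_comp_mul_sub (f := g) (a := 0) (b := x) two_ne_zero x, Complex.real_smul,
    show (2 : ℝ) * 0 - x = -x by ring, show 2 * x - x = x by ring]
  push_cast
  ring

theorem integral_symm_eq_right (g : ℝ → ℂ) (x : ℝ) :
    (∫ t in (-x)..x, g t) = 2 * ∫ r in (0 : ℝ)..x, g (x - 2 * r) := by
  rw [integral_comp_sub_mul (f := g) (a := 0) (b := x) two_ne_zero x, Complex.real_smul,
    show x - (2 : ℝ) * 0 = x by ring, show x - 2 * x = -x by ring]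
  push_cast
  ring

/-! ### The integrated Goursat problem and the Duhamel identity -/

/-- The right-hand side of the Goursat problem in the characteristic coordinates, in integrated
form. -/
def goursatIntegral (q : ℝ → ℂ) (h : ℂ) (K : ℝ → ℝ → ℂ) (u v : ℝ) : ℂ :=
  h / 2 + (1 / 2) * (∫ s in (0 : ℝ)..u, q s) +
    ∫ s in (0 : ℝ)..u, ∫ r in (0 : ℝ)..v, q (s + r) * K (s + r) (s - r)

/-- `½ ∫₀ˣ q(y) T[f(· + x - y) - f(· - x + y)](y) dy` -/
def duhamelSub (q : ℝ → ℂ) (K : ℝ → ℝ → ℂ) (f : ℝ → ℂ) (x : ℝ) : ℂ :=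
  ∫ y in (0 : ℝ)..x, (1 / 2) * q y *
    (volterra K (fun t => f (t + (x - y))) y - volterra K (fun t => f (t + (y - x))) y)

/-- `½ ∫₀ˣ q(y) T[f(· + x - y) + f(· - x + y)](y) dy` -/
def duhamelAdd (q : ℝ → ℂ) (K : ℝ → ℝ → ℂ) (f : ℝ → ℂ) (x : ℝ) : ℂ :=
  ∫ y in (0 : ℝ)..x, (1 / 2) * q y *
    (volterra K (fun t => f (t + (x - y))) y + volterra K (fun t => f (t + (y - x))) y)

section Global

variable {q : ℝ → ℂ} {h : ℂ} {K : ℝ → ℝ → ℂ} {f f' f'' : ℝ → ℂ}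

theorem continuous_volterra_shift (hK : Continuous (uncurry K)) (hf : Continuous f) :
    Continuous (uncurry fun c y => volterra K (fun t => f (t + c)) y) := by
  unfold volterra
  refine Continuous.add (by fun_prop) (continuous_integral_bounds
    (F := fun (p : ℝ × ℝ) t => K p.2 t * f (t + p.1)) ?_ (by fun_prop) (by fun_prop))
  exact (hK.comp (by fun_prop : Continuous fun p : (ℝ × ℝ) × ℝ => (p.1.2, p.2))).mul
    (hf.comp (by fun_prop : Continuous fun p : (ℝ × ℝ) × ℝ => p.2 + p.1.1))

theorem hasDerivAt_volterra_shift (hK : Continuous (uncurry K)) (hf : ∀ x, HasDerivAt f (f' x) x)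
    (hf' : Continuous f') (c y : ℝ) :
    HasDerivAt (fun c => volterra K (fun t => f (t + c)) y)
      (volterra K (fun t => f' (t + c)) y) c := by
  have hfc : Continuous f := continuous_iff_continuousAt.2 fun x => (hf x).continuousAt
  have hKy : Continuous fun p : ℝ × ℝ => K y p.2 :=
    hK.comp (by fun_prop : Continuous fun p : ℝ × ℝ => (y, p.2))
  unfold volterra
  refine HasDerivAt.add ((hf (y + c)).comp_const_add y c) (hasDerivAt_integral_of_continuous
    (F := fun c t => K y t * f (t + c)) (F' := fun c t => K y t * f' (t + c)) ?_ ?_ ?_ _ _ _)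
  · exact hKy.mul (hfc.comp (by fun_prop : Continuous fun p : ℝ × ℝ => p.2 + p.1))
  · exact hKy.mul (hf'.comp (by fun_prop : Continuous fun p : ℝ × ℝ => p.2 + p.1))
  · exact fun c t => ((hf (t + c)).comp_const_add t c).const_mul _

/-- At y = x the two shifts coincide, so the boundary term cancels. The shifts depend on x with
opposite signs, which turns the difference into a sum. -/
theorem hasDerivAt_duhamelSub (hq : Continuous q) (hK : Continuous (uncurry K))
    (hf : ∀ x, HasDerivAt f (f' x) x) (hf' : Continuous f') (x : ℝ) :
    HasDerivAt (duhamelSub q K f) (duhamelAdd q K f' x) x := by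
  have hfc : Continuous f := continuous_iff_continuousAt.2 fun x => (hf x).continuousAt
  have W := continuous_volterra_shift hK hfc
  have W' := continuous_volterra_shift hK hf'
  have hq2 : Continuous fun p : ℝ × ℝ => (1 / 2) * q p.2 := by fun_prop
  have c₁ : Continuous fun p : ℝ × ℝ => (p.1 - p.2, p.2) := by fun_prop
  have c₂ : Continuous fun p : ℝ × ℝ => (p.2 - p.1, p.2) := by fun_prop
  have := hasDerivAt_integral_diag
    (F := fun x y => (1 / 2) * q y *
      (volterra K (fun t => f (t + (x - y))) y - volterra K (fun t => f (t + (y - x))) y))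
    (F' := fun x y => (1 / 2) * q y *
      (volterra K (fun t => f' (t + (x - y))) y + volterra K (fun t => f' (t + (y - x))) y))
    (hq2.mul ((W.comp c₁).sub (W.comp c₂))) (hq2.mul ((W'.comp c₁).add (W'.comp c₂)))
    (fun x y => by
      have h₁ := (hasDerivAt_volterra_shift hK hf hf' (x - y) y).comp_sub_const x y
      have h₂ := (hasDerivAt_volterra_shift hK hf hf' (y - x) y).comp_const_sub y x
      simpa using (h₁.fun_sub h₂).const_mul ((1 / 2) * q y)) x
  refine this.congr_deriv ?_
  simp only [sub_self, mul_zero, zero_add, duhamelAdd]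

/-- Here the two equal boundary terms add up to q T f; this is the source of the potential term in
(T f)''. -/
theorem hasDerivAt_duhamelAdd (hq : Continuous q) (hK : Continuous (uncurry K))
    (hf : ∀ x, HasDerivAt f (f' x) x) (hf' : Continuous f') (x : ℝ) :
    HasDerivAt (duhamelAdd q K f) (q x * volterra K f x + duhamelSub q K f' x) x := by
  have hfc : Continuous f := continuous_iff_continuousAt.2 fun x => (hf x).continuousAt
  have W := continuous_volterra_shift hK hfc
  have W' := continuous_volterra_shift hK hf'
  have hq2 : Continuous fun p : ℝ × ℝ => (1 / 2) * q p.2 := by fun_prop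
  have c₁ : Continuous fun p : ℝ × ℝ => (p.1 - p.2, p.2) := by fun_prop
  have c₂ : Continuous fun p : ℝ × ℝ => (p.2 - p.1, p.2) := by fun_prop
  have := hasDerivAt_integral_diag
    (F := fun x y => (1 / 2) * q y *
      (volterra K (fun t => f (t + (x - y))) y + volterra K (fun t => f (t + (y - x))) y))
    (F' := fun x y => (1 / 2) * q y *
      (volterra K (fun t => f' (t + (x - y))) y - volterra K (fun t => f' (t + (y - x))) y))
    (hq2.mul ((W.comp c₁).add (W.comp c₂))) (hq2.mul ((W'.comp c₁).sub (W'.comp c₂)))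
    (fun x y => by
      have h₁ := (hasDerivAt_volterra_shift hK hf hf' (x - y) y).comp_sub_const x y
      have h₂ := (hasDerivAt_volterra_shift hK hf hf' (y - x) y).comp_const_sub y x
      simpa [sub_eq_add_neg] using (h₁.fun_add h₂).const_mul ((1 / 2) * q y)) x
  have e : (1 / 2) * q x * (volterra K (fun t => f (t + (x - x))) x +
      volterra K (fun t => f (t + (x - x))) x) = q x * volterra K f x := by
    simp only [sub_self, add_zero]
    ring
  refine this.congr_deriv ?_
  rw [e, duhamelSub]

theorem continuous_goursat_source (hq : Continuous q) (hK : Continuous (uncurry K)) :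
    Continuous (uncurry fun s r => q (s + r) * K (s + r) (s - r)) :=
  (hq.comp (by fun_prop : Continuous fun p : ℝ × ℝ => p.1 + p.2)).mul
    (hK.comp (by fun_prop : Continuous fun p : ℝ × ℝ => (p.1 + p.2, p.1 - p.2)))

theorem continuous_goursatIntegral_left (hq : Continuous q) (hK : Continuous (uncurry K)) :
    Continuous (uncurry fun u v =>
      (1 / 2) * q u + ∫ r in (0 : ℝ)..v, q (u + r) * K (u + r) (u - r)) :=
  Continuous.add (f := fun p : ℝ × ℝ => (1 / 2) * q p.1) (by fun_prop)
    (continuous_primitive (continuous_goursat_source hq hK))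

theorem continuous_goursatIntegral_right (hq : Continuous q) (hK : Continuous (uncurry K)) :
    Continuous (uncurry fun u v => ∫ s in (0 : ℝ)..u, q (s + v) * K (s + v) (s - v)) :=
  (continuous_primitive (F := fun v s => q (s + v) * K (s + v) (s - v))
    ((continuous_goursat_source hq hK).comp continuous_swap)).comp continuous_swap

theorem hasDerivAt_goursatIntegral_left (hq : Continuous q) (hK : Continuous (uncurry K))
    (u v : ℝ) :
    HasDerivAt (fun u => goursatIntegral q h K u v)
      ((1 / 2) * q u + ∫ r in (0 : ℝ)..v, q (u + r) * K (u + r) (u - r)) u := by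
  refine (((hasDerivAt_primitive hq u).const_mul _).const_add _).add (hasDerivAt_primitive ?_ u)
  exact continuous_left (continuous_primitive (continuous_goursat_source hq hK)) v

theorem hasDerivAt_goursatIntegral_right (hq : Continuous q) (hK : Continuous (uncurry K))
    (u v : ℝ) :
    HasDerivAt (fun v => goursatIntegral q h K u v)
      (∫ s in (0 : ℝ)..u, q (s + v) * K (s + v) (s - v)) v := by
  have hF := continuous_goursat_source hq hK
  refine HasDerivAt.const_add _ (hasDerivAt_integral_of_continuous
    (F := fun v s => ∫ r in (0 : ℝ)..v, q (s + r) * K (s + r) (s - r))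
    (F' := fun v s => q (s + v) * K (s + v) (s - v)) ?_ ?_ ?_ _ _ _)
  · exact (continuous_primitive hF).comp continuous_swap
  · exact hF.comp continuous_swap
  · exact fun v s => hasDerivAt_primitive (continuous_right hF s) v

theorem contDiff_goursatIntegral (hq : Continuous q) (hK : Continuous (uncurry K)) :
    ContDiff ℝ 1 (uncurry (goursatIntegral q h K)) :=
  contDiff_one_of_continuous_partials (continuous_goursatIntegral_left hq hK)
    (continuous_goursatIntegral_right hq hK) (hasDerivAt_goursatIntegral_left hq hK)
    (hasDerivAt_goursatIntegral_right hq hK)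

theorem hasDerivAt_goursatIntegral_char (hq : Continuous q) (hK : Continuous (uncurry K))
    (x t : ℝ) :
    HasDerivAt (fun t => goursatIntegral q h K ((x + t) / 2) ((x - t) / 2))
      ((1 / 2) * ((1 / 2) * q ((x + t) / 2) + ∫ r in (0 : ℝ)..(x - t) / 2,
          q ((x + t) / 2 + r) * K ((x + t) / 2 + r) ((x + t) / 2 - r)) -
        (1 / 2) * ∫ s in (0 : ℝ)..(x + t) / 2,
          q (s + (x - t) / 2) * K (s + (x - t) / 2) (s - (x - t) / 2)) t := by
  have H := (hasStrictFDerivAt_of_continuous_partials (continuous_goursatIntegral_left hq hK)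
    (continuous_goursatIntegral_right hq hK) (hasDerivAt_goursatIntegral_left (h := h) hq hK)
    (hasDerivAt_goursatIntegral_right hq hK) ((x + t) / 2, (x - t) / 2)).hasFDerivAt
  have hp : HasDerivAt (fun t : ℝ => ((x + t) / 2, (x - t) / 2)) ((1 / 2 : ℝ), (-1 / 2 : ℝ)) t :=
    (((hasDerivAt_id t).const_add x).div_const 2).prodMk
      (((hasDerivAt_id t).const_sub x).div_const 2)
  have := H.comp_hasDerivAt (f := fun t : ℝ => ((x + t) / 2, (x - t) / 2)) t hp
  refine this.congr_deriv ?_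
  simp only [ContinuousLinearMap.coprod_apply, ContinuousLinearMap.toSpanSingleton_apply,
    Complex.real_smul]
  push_cast
  ring

/-- Integrate by parts. The t-derivative of G is half the difference of its u- and v-partials, each
an integral along a characteristic. With y = s + r each becomes an integral over a triangle; once y
is made the outer variable, the inner integral is the integral part of T applied to a translate of
f. -/
theorem integral_goursatIntegral_mul (hq : Continuous q) (hK : Continuous (uncurry K))
    (hf : ∀ x, HasDerivAt f (f' x) x) (hf' : Continuous f') (x : ℝ) :
    (∫ t in (-x)..x, goursatIntegral q h K ((x + t) / 2) ((x - t) / 2) * f' t) =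
      h / 2 * (f x - f (-x)) + duhamelSub q K f x := by
  have hfc : Continuous f := continuous_iff_continuousAt.2 fun x => (hf x).continuousAt
  set Gl : ℝ → ℝ → ℂ := fun u v =>
      (1 / 2) * q u + ∫ r in (0 : ℝ)..v, q (u + r) * K (u + r) (u - r) with hGl
  set Gr : ℝ → ℝ → ℂ := fun u v => ∫ s in (0 : ℝ)..u, q (s + v) * K (s + v) (s - v) with hGr
  have cGl : Continuous (uncurry Gl) := continuous_goursatIntegral_left hq hK
  have cGr : Continuous (uncurry Gr) := continuous_goursatIntegral_right hq hK
  have cl : Continuous fun t => Gl ((x + t) / 2) ((x - t) / 2) * f t :=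
    (cGl.comp (by fun_prop : Continuous fun t : ℝ => ((x + t) / 2, (x - t) / 2))).mul hfc
  have cr : Continuous fun t => Gr ((x + t) / 2) ((x - t) / 2) * f t :=
    (cGr.comp (by fun_prop : Continuous fun t : ℝ => ((x + t) / 2, (x - t) / 2))).mul hfc
  have parts := integral_mul_deriv_eq_deriv_mul (a := -x) (b := x)
    (fun t _ => hasDerivAt_goursatIntegral_char (h := h) hq hK x t) (fun t _ => hf t)
    (Continuous.intervalIntegrable (by
      exact (((cGl.comp (by fun_prop : Continuous fun t : ℝ => ((x + t) / 2, (x - t) / 2))).const_smul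
        (1 / 2 : ℂ)).sub
       ((cGr.comp (by fun_prop : Continuous fun t : ℝ => ((x + t) / 2, (x - t) / 2))).const_smul
        (1 / 2 : ℂ)))) _ _)
    (hf'.intervalIntegrable _ _)
  have split : (∫ t in (-x)..x, ((1 / 2) * Gl ((x + t) / 2) ((x - t) / 2) -
      (1 / 2) * Gr ((x + t) / 2) ((x - t) / 2)) * f t) =
      (1 / 2) * (∫ t in (-x)..x, Gl ((x + t) / 2) ((x - t) / 2) * f t) -
      (1 / 2) * ∫ t in (-x)..x, Gr ((x + t) / 2) ((x - t) / 2) * f t := by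
    rw [← intervalIntegral.integral_const_mul, ← intervalIntegral.integral_const_mul, ← intervalIntegral.integral_sub
      ((cl.intervalIntegrable _ _).const_mul _) ((cr.intervalIntegrable _ _).const_mul _)]
    congr 1 with t
    ring
  have hFl : ∀ s, (∫ r in (0 : ℝ)..x - s, q (s + r) * K (s + r) (s - r)) =
      ∫ y in s..x, q y * K y (2 * s - y) := fun s => by
    have := integral_comp_add_left (a := 0) (b := x - s) (fun y => q y * K y (2 * s - y)) s
    rw [add_zero, add_sub_cancel] at this
    rw [← this]
    congr 1 with r
    ring_nf
  have hFr : ∀ r, (∫ s in (0 : ℝ)..x - r, q (s + r) * K (s + r) (s - r)) =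
      ∫ y in r..x, q y * K y (y - 2 * r) := fun r => by
    have := integral_comp_add_right (a := 0) (b := x - r) (fun y => q y * K y (y - 2 * r)) r
    rw [zero_add, sub_add_cancel] at this
    rw [← this]
    congr 1 with s
    ring_nf
  have cqKl : Continuous (uncurry fun s y => q y * K y (2 * s - y) * f (2 * s - x)) :=
    ((hq.comp continuous_snd).mul (hK.comp
      (by fun_prop : Continuous fun p : ℝ × ℝ => (p.2, 2 * p.1 - p.2)))).mul
      (hfc.comp (by fun_prop : Continuous fun p : ℝ × ℝ => 2 * p.1 - x))
  have cqKr : Continuous (uncurry fun r y => q y * K y (y - 2 * r) * f (x - 2 * r)) :=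
    ((hq.comp continuous_snd).mul (hK.comp
      (by fun_prop : Continuous fun p : ℝ × ℝ => (p.2, p.2 - 2 * p.1)))).mul
      (hfc.comp (by fun_prop : Continuous fun p : ℝ × ℝ => x - 2 * p.1))
  -- The term q/2 in the u-partial supplies exactly the identity part of T on the translate of f.
  have left : (1 / 2) * (∫ t in (-x)..x, Gl ((x + t) / 2) ((x - t) / 2) * f t) =
      ∫ y in (0 : ℝ)..x, (1 / 2) * q y * volterra K (fun t => f (t + (y - x))) y := by
    rw [integral_symm_eq_left, ← mul_assoc, one_div_mul_cancel two_ne_zero, one_mul]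
    have e : ∀ s : ℝ, Gl ((x + (2 * s - x)) / 2) ((x - (2 * s - x)) / 2) * f (2 * s - x) =
        (1 / 2) * q s * f (2 * s - x) + ∫ y in s..x, q y * K y (2 * s - y) * f (2 * s - x) := by
      intro s
      rw [intervalIntegral.integral_mul_const, ← hFl, hGl]
      ring_nf
    simp only [e]
    have c₂ : Continuous fun s => ∫ y in s..x, q y * K y (2 * s - y) * f (2 * s - x) :=
      continuous_integral_bounds cqKl continuous_id continuous_const
    have c₃ : Continuous fun y => ∫ s in (0 : ℝ)..y, q y * K y (2 * s - y) * f (2 * s - x) :=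
      continuous_integral_bounds (F := fun y s => q y * K y (2 * s - y) * f (2 * s - x))
        (cqKl.comp continuous_swap) continuous_const continuous_id
    have c₁ : Continuous fun s => (1 / 2) * q s * f (2 * s - x) := by fun_prop
    rw [intervalIntegral.integral_add (c₁.intervalIntegrable _ _) (c₂.intervalIntegrable _ _),
      integral_triangle_swap cqKl, ← intervalIntegral.integral_add (c₁.intervalIntegrable _ _)
        (c₃.intervalIntegrable _ _)]
    congr 1 with y
    rw [volterra, integral_symm_eq_left]
    simp only [mul_assoc, intervalIntegral.integral_const_mul]
    ring_nf
  -- The v-partial has no such term, so the identity part f(x) is subtracted here; the boundary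
  -- value G(x,0) f(x) restores it below.
  have right : (1 / 2) * (∫ t in (-x)..x, Gr ((x + t) / 2) ((x - t) / 2) * f t) =
      ∫ y in (0 : ℝ)..x, (1 / 2) * q y *
        (volterra K (fun t => f (t + (x - y))) y - f x) := by
    rw [integral_symm_eq_right, ← mul_assoc, one_div_mul_cancel two_ne_zero, one_mul]
    have e : ∀ r : ℝ, Gr ((x + (x - 2 * r)) / 2) ((x - (x - 2 * r)) / 2) * f (x - 2 * r) =
        ∫ y in r..x, q y * K y (y - 2 * r) * f (x - 2 * r) := by
      intro r
      rw [intervalIntegral.integral_mul_const, ← hFr, hGr,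
        show (x + (x - 2 * r)) / 2 = x - r by ring, show (x - (x - 2 * r)) / 2 = r by ring]
    simp only [e]
    rw [integral_triangle_swap cqKr]
    congr 1 with y
    have e' : ∀ r : ℝ, y - 2 * r + (x - y) = x - 2 * r := fun r => by ring
    rw [volterra, integral_symm_eq_right]
    simp only [mul_assoc, intervalIntegral.integral_const_mul, e', add_sub_cancel]
    ring
  have cW := continuous_volterra_shift hK hfc
  have cA : Continuous fun y => (1 / 2) * q y * volterra K (fun t => f (t + (y - x))) y :=
    Continuous.mul (by fun_prop) (cW.comp (by fun_prop : Continuous fun y : ℝ => (y - x, y)))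
  have cB : Continuous fun y => (1 / 2) * q y * (volterra K (fun t => f (t + (x - y))) y - f x) :=
    Continuous.mul (by fun_prop) ((cW.comp (by fun_prop : Continuous fun y : ℝ => (x - y, y))).sub
      continuous_const)
  have sum : duhamelSub q K f x = (1 / 2) * (∫ s in (0 : ℝ)..x, q s) * f x +
      (∫ y in (0 : ℝ)..x, (1 / 2) * q y * (volterra K (fun t => f (t + (x - y))) y - f x)) -
      ∫ y in (0 : ℝ)..x, (1 / 2) * q y * volterra K (fun t => f (t + (y - x))) y := by
    have cq : Continuous fun y => (1 / 2) * q y * f x := by fun_prop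
    have cs : Continuous fun y => (1 / 2) * q y * f x +
        (1 / 2) * q y * (volterra K (fun t => f (t + (x - y))) y - f x) := cq.add cB
    rw [← intervalIntegral.integral_const_mul, ← intervalIntegral.integral_mul_const,
      ← intervalIntegral.integral_add (cq.intervalIntegrable _ _) (cB.intervalIntegrable _ _),
      ← intervalIntegral.integral_sub (cs.intervalIntegrable _ _)
        (cA.intervalIntegrable _ _), duhamelSub]
    congr 1 with y
    ring
  rw [sum, ← left, ← right, parts, split]
  simp only [goursatIntegral, add_self_div_two, sub_self, zero_div, add_neg_cancel, sub_neg_eq_add,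
    integral_same, intervalIntegral.integral_zero, add_zero, mul_zero]
  ring

end Global

/-! ### Uniqueness, extension and completeness of exponentials on an interval -/

theorem eq_of_hasDerivWithinAt_zero {a : ℝ} {f : ℝ → ℂ}
    (hf : ∀ x ∈ Icc (-a) a, HasDerivWithinAt f 0 (Icc (-a) a) x) {x y : ℝ}
    (hx : x ∈ Icc (-a) a) (hy : y ∈ Icc (-a) a) : f x = f y := by
  have := (convex_Icc (-a) a).norm_image_sub_le_of_norm_hasDerivWithin_le (C := 0) hf
    (fun _ _ => by simp) hy hx
  simpa [sub_eq_zero] using this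

/-- On `[-a, a]` the equation `d'' = κ² d` with zero Cauchy data at `0` has only the zero
solution. -/
theorem eq_zero_of_isSolution {a : ℝ} (ha : 0 ≤ a) (κ : ℂ) {d d₁ : ℝ → ℂ}
    (hd : IsSolution a (fun _ => κ ^ 2) d d₁) (h0 : d 0 = 0) (h1 : d₁ 0 = 0) {x : ℝ}
    (hx : x ∈ Icc (-a) a) : d x = 0 := by
  have hexp : ∀ (c : ℂ) (x : ℝ),
      HasDerivWithinAt (fun x : ℝ => Complex.exp (c * x)) (Complex.exp (c * x) * c) (Icc (-a) a) x := by
    intro c x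
    have : HasDerivAt (fun x : ℝ => c * (x : ℂ)) c x := by
      simpa using (Complex.ofRealCLM.hasDerivAt (x := x)).const_mul c
    exact this.cexp.hasDerivWithinAt
  have m0 : (0 : ℝ) ∈ Icc (-a) a := ⟨by linarith, ha⟩
  -- The operator factors as (∂+κ)(∂-κ), and each factor is removed by an integrating factor. This
  -- covers κ = 0 as well.
  have e1 : ∀ x ∈ Icc (-a) a, d₁ x = κ * d x := by
    intro x hx
    have := eq_of_hasDerivWithinAt_zero (a := a)
      (f := fun x => Complex.exp (κ * x) * (d₁ x - κ * d x)) (fun x hx => by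
        refine ((hexp κ x).fun_mul ((hd x hx).2.fun_sub ((hd x hx).1.const_mul κ))).congr_deriv ?_
        ring) hx m0
    simpa [h0, h1, sub_eq_zero] using this
  have := eq_of_hasDerivWithinAt_zero (a := a)
    (f := fun x => Complex.exp (-κ * x) * d x) (fun x hx => by
      refine ((hexp (-κ) x).fun_mul (hd x hx).1).congr_deriv ?_
      rw [e1 x hx]
      ring) hx m0
  simpa [h0] using this

/-- A differentiable function on `[-a, a]` extends to the line along any continuous extension of its
derivative. -/
theorem exists_extension_of_hasDerivWithinAt {a : ℝ} (ha : 0 ≤ a) {v v₁ f₁ : ℝ → ℂ}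
    (h₁ : ∀ x ∈ Icc (-a) a, HasDerivWithinAt v (v₁ x) (Icc (-a) a) x)
    (c₁ : Continuous f₁) (e₁ : EqOn f₁ v₁ (Icc (-a) a)) :
    ∃ f : ℝ → ℂ, (∀ x, HasDerivAt f (f₁ x) x) ∧ EqOn f v (Icc (-a) a) := by
  have m0 : (0 : ℝ) ∈ Icc (-a) a := ⟨by linarith, ha⟩
  have d : ∀ x, HasDerivAt (fun x => v 0 + ∫ t in (0 : ℝ)..x, f₁ t) (f₁ x) x :=
    fun x => (hasDerivAt_primitive c₁ x).const_add _
  refine ⟨_, d, fun x hx => ?_⟩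
  have := eq_of_hasDerivWithinAt_zero (a := a)
    (f := fun x => v 0 + (∫ t in (0 : ℝ)..x, f₁ t) - v x) (fun x hx => by
      simpa [e₁ hx] using (d x).hasDerivWithinAt.fun_sub (h₁ x hx)) hx m0
  simpa [sub_eq_zero] using this

theorem exists_continuous_extension_Icc {a : ℝ} (ha : 0 ≤ a) {v : ℝ → ℂ}
    (hv : ContinuousOn v (Icc (-a) a)) : ∃ f : ℝ → ℂ, Continuous f ∧ EqOn f v (Icc (-a) a) := by
  have hab : -a ≤ a := by linarith
  exact ⟨IccExtend hab ((Icc (-a) a).domRestrict v), hv.domRestrict.Icc_extend',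
    fun x hx => IccExtend_of_mem hab _ hx⟩

/-- Twice differentiable functions on `[-a, a]` are restrictions of twice differentiable functions
on the line. -/
theorem exists_extension_twice_differentiable {a : ℝ} (ha : 0 ≤ a) {v v₁ v₂ : ℝ → ℂ}
    (h₁ : ∀ x ∈ Icc (-a) a, HasDerivWithinAt v (v₁ x) (Icc (-a) a) x)
    (h₂ : ∀ x ∈ Icc (-a) a, HasDerivWithinAt v₁ (v₂ x) (Icc (-a) a) x)
    (hv : ContinuousOn v₂ (Icc (-a) a)) :
    ∃ f f₁ f₂ : ℝ → ℂ, (∀ x, HasDerivAt f (f₁ x) x) ∧ (∀ x, HasDerivAt f₁ (f₂ x) x) ∧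
      Continuous f₂ ∧ EqOn f v (Icc (-a) a) ∧ EqOn f₁ v₁ (Icc (-a) a) ∧
      EqOn f₂ v₂ (Icc (-a) a) := by
  obtain ⟨f₂, c₂, e₂⟩ := exists_continuous_extension_Icc ha hv
  obtain ⟨f₁, d₁, e₁⟩ := exists_extension_of_hasDerivWithinAt ha h₂ c₂ e₂
  obtain ⟨f, d, e⟩ := exists_extension_of_hasDerivWithinAt ha h₁
    (continuous_iff_continuousAt.2 fun x => (d₁ x).continuousAt) e₁
  exact ⟨f, f₁, f₂, d, d₁, c₂, e, e₁, e₂⟩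

/-- A continuous function on `[-x, x]` that is orthogonal to all exponentials vanishes. -/
theorem eq_zero_of_integral_mul_exp_eq_zero {g : ℝ → ℂ} (hg : Continuous g) {x : ℝ}
    (h : ∀ κ : ℂ, (∫ t in (-x)..x, g t * Complex.exp (κ * t)) = 0) {t : ℝ} (ht : |t| ≤ |x|)
    (hx : x ≠ 0) : g t = 0 := by
  set b := |x| with hb
  have hb0 : 0 < b := abs_pos.2 hx
  have hbb : -b < b := by linarith
  have h' : ∀ κ : ℂ, (∫ t in (-b)..b, g t * Complex.exp (κ * t)) = 0 := by
    intro κ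
    rcases abs_choice x with e | e
    · rw [hb, e, h]
    · rw [hb, e, neg_neg, integral_symm, h, neg_zero]
  have hc : ∀ n : ℤ, fourierCoeffOn hbb g n = 0 := by
    intro n
    rw [fourierCoeffOn_eq_integral]
    -- For this κ the exponential is the Fourier mode -n of period 2b. All Fourier coefficients of g
    -- vanish, so Parseval forces ∫|g|² = 0.
    have := h' (2 * Real.pi * Complex.I * (-n : ℤ) / ((b - -b : ℝ) : ℂ))
    rw [show (∫ t in (-b)..b, fourier (-n) (t : AddCircle (b - -b)) • g t) = 0 from ?_, smul_zero]
    rw [← this]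
    congr 1 with t
    rw [fourier_coe_apply, smul_eq_mul, mul_comm]
    congr 2
    ring
  have hL2 : MemLp g 2 (volume.restrict (Ioc (-b) b)) := by
    obtain ⟨C, hC⟩ := (isCompact_Icc (a := -b) (b := b)).exists_bound_of_continuousOn hg.continuousOn
    refine MemLp.of_bound hg.aestronglyMeasurable C ?_
    exact (ae_restrict_mem measurableSet_Ioc).mono fun t ht => hC t (Ioc_subset_Icc_self ht)
  have hs := hasSum_sq_fourierCoeffOn hbb hL2
  simp only [hc, norm_zero, ne_eq, OfNat.ofNat_ne_zero, not_false_eq_true, zero_pow] at hs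
  have hz := hs.unique hasSum_zero
  by_contra hne
  have hpos : 0 < ∫ s in (-b)..b, ‖g s‖ ^ 2 :=
    integral_pos hbb (by fun_prop) (fun _ _ => by positivity)
      ⟨t, abs_le.1 ht, by positivity⟩
  have : 0 < (b - -b)⁻¹ := by positivity
  simp only [smul_eq_mul, mul_eq_zero, this.ne', hpos.ne', or_self] at hz

theorem char_mem_charDomain {a x t : ℝ} (hx : |x| ≤ a) (ht : |t| ≤ |x|) :
    ((x + t) / 2, (x - t) / 2) ∈ charDomain a := by
  have := sq_le_sq.2 ht
  refine ⟨?_, ?_⟩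
  · show 0 ≤ (x + t) / 2 * ((x - t) / 2)
    nlinarith
  · show |(x + t) / 2 + (x - t) / 2| ≤ a
    rwa [← add_div, add_add_sub_cancel, add_self_div_two]

theorem abs_le_of_mem_uIoc_neg {x t : ℝ} (ht : t ∈ uIoc (-x) x) : |t| ≤ |x| := by
  have := uIoc_subset_uIcc ht
  rw [mem_uIcc] at this
  rcases this with h | h
  · exact (abs_le.2 h).trans (le_abs_self x)
  · rw [← abs_neg x]
    exact (abs_le.2 ⟨by linarith, h.2⟩).trans (le_abs_self _)

theorem continuous_apply₂ {X : Type*} [TopologicalSpace X] {F : ℝ → ℝ → ℂ}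
    (hF : Continuous (uncurry F)) {b c : X → ℝ} (hb : Continuous b) (hc : Continuous c) :
    Continuous fun p => F (b p) (c p) := hF.comp (hb.prodMk hc)

/-! ### The integral equation and the intertwining relation -/

/-- The Goursat problem in the characteristic coordinates, in integrated form. -/
def SolvesIntegralEquation (a : ℝ) (q : ℝ → ℂ) (h : ℂ) (K : ℝ → ℝ → ℂ) : Prop :=
  ∀ u v, (u, v) ∈ charDomain a → K (u + v) (u - v) = goursatIntegral q h K u v

section Kernel

variable {a : ℝ} {q : ℝ → ℂ} {h : ℂ} {K : ℝ → ℝ → ℂ} {f f₁ f₂ : ℝ → ℂ}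

/-- The kernel may be replaced by G under the integral. The right-hand side can then be
differentiated although K is only continuous. -/
theorem SolvesIntegralEquation.volterra_eq (hI : SolvesIntegralEquation a q h K)
    (hq : Continuous q) (hK : Continuous (uncurry K)) (hf : ∀ x, HasDerivAt f (f₁ x) x)
    (hf' : Continuous f₁) {x : ℝ} (hx : |x| ≤ a) :
    volterra K f₁ x = f₁ x + h / 2 * (f x - f (-x)) + duhamelSub q K f x := by
  rw [volterra, add_assoc, ← integral_goursatIntegral_mul hq hK hf hf']
  congr 1
  refine integral_congr_ae (Eventually.of_forall fun t ht => ?_)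
  have := hI _ _ (char_mem_charDomain hx (abs_le_of_mem_uIoc_neg ht))
  rw [← this]
  ring_nf

/-- The function `x ↦ f(x) + (h/2) (F(x) - F(-x)) + ½ ∫₀ˣ ...` where `F' = f`, and its first two
derivatives. -/
theorem hasDerivAt_duhamel (hq : Continuous q) (hK : Continuous (uncurry K)) {F : ℝ → ℂ}
    (hF : ∀ x, HasDerivAt F (f x) x) (hf : ∀ x, HasDerivAt f (f₁ x) x)
    (hf₁ : ∀ x, HasDerivAt f₁ (f₂ x) x) (x : ℝ) :
    HasDerivAt (fun x => f x + h / 2 * (F x - F (-x)) + duhamelSub q K F x)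
      (f₁ x + h / 2 * (f x + f (-x)) + duhamelAdd q K f x) x ∧
    HasDerivAt (fun x => f₁ x + h / 2 * (f x + f (-x)) + duhamelAdd q K f x)
      (f₂ x + h / 2 * (f₁ x - f₁ (-x)) + (q x * volterra K f x + duhamelSub q K f₁ x)) x := by
  have cf : Continuous f := continuous_iff_continuousAt.2 fun x => (hf x).continuousAt
  have cf₁ : Continuous f₁ := continuous_iff_continuousAt.2 fun x => (hf₁ x).continuousAt
  have hn : ∀ {g g' : ℝ → ℂ}, (∀ x, HasDerivAt g (g' x) x) →
      HasDerivAt (fun x => g (-x)) (-g' (-x)) x := fun hg => by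
    simpa [comp_def] using (hg (-x)).scomp x (hasDerivAt_neg x)
  constructor
  · refine (((hf x).add (((hF x).sub (hn hF)).const_mul (h / 2))).add
      (hasDerivAt_duhamelSub hq hK hF cf x)).congr_deriv ?_
    ring
  · refine (((hf₁ x).add (((hf x).add (hn hf)).const_mul (h / 2))).add
      (hasDerivAt_duhamelAdd hq hK hf cf₁ x)).congr_deriv ?_
    ring

/-- The intertwining property `(T f)'' = q T f + T f''`. -/
theorem SolvesIntegralEquation.intertwines (hI : SolvesIntegralEquation a q h K)
    (hq : Continuous q) (hK : Continuous (uncurry K)) (hf : ∀ x, HasDerivAt f (f₁ x) x)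
    (hf₁ : ∀ x, HasDerivAt f₁ (f₂ x) x) (hf₂ : Continuous f₂) {x : ℝ} (hx : x ∈ Icc (-a) a) :
    HasDerivWithinAt (volterra K f) (f₁ x + h / 2 * (f x + f (-x)) + duhamelAdd q K f x)
      (Icc (-a) a) x ∧
    HasDerivWithinAt (fun x => f₁ x + h / 2 * (f x + f (-x)) + duhamelAdd q K f x)
      (q x * volterra K f x + volterra K f₂ x) (Icc (-a) a) x := by
  have cf : Continuous f := continuous_iff_continuousAt.2 fun x => (hf x).continuousAt
  have hF := hasDerivAt_primitive cf
  have hD := hasDerivAt_duhamel (h := h) hq hK hF hf hf₁ x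
  refine ⟨hD.1.hasDerivWithinAt.congr_of_mem
    (fun y hy => hI.volterra_eq hq hK hF cf (abs_le.2 hy)) hx, ?_⟩
  refine hD.2.hasDerivWithinAt.congr_deriv ?_
  -- Second use of the Duhamel formula: now for `f₂` with primitive `f₁`, whereas above it was for
  -- `f` with primitive ∫₀ˣ f.
  rw [hI.volterra_eq hq hK hf₁ hf₂ (abs_le.2 hx)]
  ring

/-! ### From property (M) to the integral equation -/

theorem duhamelSub_const_mul (q : ℝ → ℂ) (K : ℝ → ℝ → ℂ) (c : ℂ) (f : ℝ → ℂ) (x : ℝ) :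
    duhamelSub q K (fun t => c * f t) x = c * duhamelSub q K f x := by
  have e : ∀ s y, volterra K (fun t => c * f (t + s)) y = c * volterra K (fun t => f (t + s)) y := by
    intro s y
    simp only [volterra, mul_left_comm _ c, intervalIntegral.integral_const_mul, mul_add]
  simp only [duhamelSub, e, ← intervalIntegral.integral_const_mul]
  congr 1 with y
  ring

theorem volterra_zero (K : ℝ → ℝ → ℂ) (f : ℝ → ℂ) : volterra K f 0 = f 0 := by
  simp [volterra]

theorem MapsSolutions.volterra_exp_eq (ha : 0 ≤ a) (hM : MapsSolutions a q h K) (hq : Continuous q)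
    (hK : Continuous (uncurry K)) (κ : ℂ) {x : ℝ} (hx : x ∈ Icc (-a) a) :
    (∫ t in (-x)..x, K x t * Complex.exp (κ * t)) =
      ∫ t in (-x)..x, goursatIntegral q h K ((x + t) / 2) ((x - t) / 2) * Complex.exp (κ * t) := by
  have hlin : ∀ (x : ℝ), HasDerivAt (fun x : ℝ => κ * (x : ℂ)) κ x := fun x => by
    simpa using (Complex.ofRealCLM.hasDerivAt (x := x)).const_mul κ
  set u : ℝ → ℂ := fun t => Complex.exp (κ * t) with hu
  have du : ∀ x, HasDerivAt u (κ * u x) x := fun x => by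
    simpa [mul_comm] using (hlin x).cexp
  have du' : ∀ x, HasDerivAt (fun x => κ * u x) (κ ^ 2 * u x) x := fun x =>
    ((du x).const_mul κ).congr_deriv (by ring)
  have cu : Continuous u := continuous_iff_continuousAt.2 fun x => (du x).continuousAt
  -- The condition κu = κ²U makes the Duhamel expression solve w'' = κ²w + q T u. The primitive u/κ
  -- does this for κ ≠ 0; for κ = 0 any primitive will do.
  obtain ⟨U, dU, eU⟩ : ∃ U : ℝ → ℂ, (∀ x, HasDerivAt U (u x) x) ∧ ∀ x, κ * u x = κ ^ 2 * U x := by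
    by_cases hκ : κ = 0
    · exact ⟨fun x => x, fun x =>
          (Complex.ofRealCLM.hasDerivAt (x := x)).congr_deriv (by simp [hu, hκ]),
        fun x => by simp [hκ]⟩
    · refine ⟨fun x => κ⁻¹ * u x, fun x => ((du x).const_mul κ⁻¹).congr_deriv ?_, fun x => ?_⟩ <;>
      field_simp
  rw [integral_goursatIntegral_mul hq hK dU cu]
  -- With ω = iκ one has -ω² = κ², so (M) applies to exp(κ·).
  obtain ⟨w₁, hw, hw0, hw1⟩ := hM.2 (Complex.I * κ) u (fun x => κ * u x) (fun x _ =>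
    ⟨(du x).hasDerivWithinAt, ((du' x).congr_deriv (by
      simp [mul_pow])).hasDerivWithinAt⟩)
  -- In the difference of `volterra K u` and the Duhamel expression the source q T u cancels,
  -- leaving d'' = κ²d with zero Cauchy data.
  have hd := eq_zero_of_isSolution (a := a) ha κ
    (d := fun x => volterra K u x - (u x + h / 2 * (U x - U (-x)) + duhamelSub q K U x))
    (d₁ := fun x => w₁ x - (κ * u x + h / 2 * (u x + u (-x)) + duhamelAdd q K u x))
    (fun x hx => by
      have hD := hasDerivAt_duhamel (h := h) hq hK dU du du' x
      refine ⟨(hw x hx).1.fun_sub hD.1.hasDerivWithinAt,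
        ((hw x hx).2.fun_sub hD.2.hasDerivWithinAt).congr_deriv ?_⟩
      have e : duhamelSub q K (fun x => κ * u x) x = κ ^ 2 * duhamelSub q K U x := by
        rw [← duhamelSub_const_mul]
        simp only [eU]
      rw [e, eU, eU, mul_pow, Complex.I_sq]
      ring) (by simp [volterra_zero, duhamelSub]) (by
      simp only [hw1, neg_zero, duhamelAdd, integral_same]
      ring) hx
  rw [volterra, add_assoc, add_sub_add_left_eq_sub, sub_eq_zero] at hd
  exact hd

theorem MapsSolutions.solvesIntegralEquation (ha : 0 < a) (hM : MapsSolutions a q h K)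
    (hq : Continuous q) (hK : Continuous (uncurry K)) : SolvesIntegralEquation a q h K := by
  have cG := (contDiff_goursatIntegral (h := h) hq hK).continuous
  have key : ∀ x t, x ∈ Icc (-a) a → |t| ≤ |x| → x ≠ 0 →
      K x t = goursatIntegral q h K ((x + t) / 2) ((x - t) / 2) := by
    intro x t hx ht hx0
    have c₁ := continuous_right hK x
    have c₂ : Continuous fun t => goursatIntegral q h K ((x + t) / 2) ((x - t) / 2) :=
      continuous_apply₂ cG (by fun_prop) (by fun_prop)
    have c₃ : Continuous fun t => K x t - goursatIntegral q h K ((x + t) / 2) ((x - t) / 2) :=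
      Continuous.sub c₁ c₂
    refine sub_eq_zero.1 (eq_zero_of_integral_mul_exp_eq_zero c₃ (fun κ => ?_) ht hx0)
    have i₁ : Continuous fun t => K x t * Complex.exp (κ * t) := by fun_prop
    have i₂ : Continuous fun t => goursatIntegral q h K ((x + t) / 2) ((x - t) / 2) *
      Complex.exp (κ * t) := by fun_prop
    simp only [sub_mul]
    rw [intervalIntegral.integral_sub (i₁.intervalIntegrable _ _) (i₂.intervalIntegrable _ _),
      hM.volterra_exp_eq ha.le hq hK κ hx, sub_self]
  intro u v huv
  have h1 : 0 ≤ u * v := huv.1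
  have h2 : |u + v| ≤ a := huv.2
  by_cases h0 : u + v = 0
  · have hu : u = 0 := by
      have : v = -u := by linarith
      subst this
      nlinarith
    have hv : v = 0 := by linarith
    subst hu hv
    -- At the origin [-x,x] degenerates and the Fourier argument says nothing; the value is the
    -- limit along t = 0 as x ↓ 0.
    have he : EqOn (fun x : ℝ => K x 0) (fun x => goursatIntegral q h K (x / 2) (x / 2))
        (Ioc 0 a) := fun x hx => by
      have := key x 0 ⟨by linarith [hx.1], hx.2⟩ (by simp) hx.1.ne'
      simpa using this
    have := he.closure (continuous_left hK 0)
      (continuous_apply₂ cG (by fun_prop) (by fun_prop))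
    rw [closure_Ioc ha.ne] at this
    simpa using this (left_mem_Icc.2 ha.le)
  · rw [key (u + v) (u - v) (abs_le.1 h2) (sq_le_sq.1 (by nlinarith)) h0]
    ring_nf

end Kernel

variable {a : ℝ} {q q' : ℝ → ℂ} {h : ℂ} {K K' : ℝ → ℝ → ℂ}

/-! ### The characteristic Goursat problem -/

theorem isOpen_charInterior (a : ℝ) : IsOpen (charInterior a) :=
  (isOpen_lt continuous_const (by fun_prop : Continuous fun p : ℝ × ℝ => p.1 * p.2)).inter
    (isOpen_lt (by fun_prop : Continuous fun p : ℝ × ℝ => |p.1 + p.2|) continuous_const)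

theorem isClosed_kernelDomain (a : ℝ) : IsClosed (kernelDomain a) :=
  (isClosed_le (by fun_prop : Continuous fun p : ℝ × ℝ => |p.2|)
    (by fun_prop : Continuous fun p : ℝ × ℝ => |p.1|)).inter
    (isClosed_le (by fun_prop : Continuous fun p : ℝ × ℝ => |p.1|) continuous_const)

theorem charInterior_subset (a : ℝ) : charInterior a ⊆ charDomain a :=
  fun _ hp => ⟨hp.1.le, hp.2.le⟩

theorem add_mem_Icc {u v : ℝ} (hp : (u, v) ∈ charDomain a) : u + v ∈ Icc (-a) a :=
  abs_le.1 hp.2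

theorem char_mem_kernelDomain {u v : ℝ} (hp : (u, v) ∈ charDomain a) :
    (u + v, u - v) ∈ kernelDomain a :=
  ⟨sq_le_sq.1 (by have h1 : 0 ≤ u * v := hp.1; show (u - v) ^ 2 ≤ (u + v) ^ 2; nlinarith), hp.2⟩

/-- The derivative conditions are local in an open set, so agreement on the domain suffices. This
allows q and K to be replaced by extensions. -/
theorem SolvesCharGoursat.congr {H H' : ℝ → ℝ → ℂ} (hH : SolvesCharGoursat a q h H)
    (hq : EqOn q' q (Icc (-a) a)) (he : EqOn (uncurry H') (uncurry H) (charDomain a)) :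
    SolvesCharGoursat a q' h H' := by
  have heI := he.mono (charInterior_subset a)
  have ho := isOpen_charInterior a
  have hr : ∀ u v, (u, v) ∈ charInterior a → ∀ᶠ v' in 𝓝 v, H' u v' = H u v' := fun u v hp =>
    ((by fun_prop : Continuous fun v' : ℝ => (u, v')).continuousAt.eventually
      (ho.mem_nhds hp)).mono fun v' hv' => heI hv'
  have hl : ∀ u v, (u, v) ∈ charInterior a → ∀ᶠ u' in 𝓝 u, H' u' v = H u' v := fun u v hp =>
    ((by fun_prop : Continuous fun u' : ℝ => (u', v)).continuousAt.eventually
      (ho.mem_nhds hp)).mono fun v' hv' => heI hv'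
  have hv : ∀ u v, (u, v) ∈ charInterior a → q' (u + v) * H' u v = q (u + v) * H u v :=
    fun u v hp => by
      rw [hq (add_mem_Icc (charInterior_subset a hp)),
        show H' u v = H u v from he (charInterior_subset a hp)]
  refine ⟨hH.continuousOn.congr he, hH.contDiffOn.congr heI, fun u v hp => ?_, fun u v hp => ?_,
    fun u hu => ?_, fun v hv => ?_⟩
  · rw [hv u v hp]
    refine (hH.deriv_u_deriv_v u v hp).congr_of_eventuallyEq ?_
    exact ((by fun_prop : Continuous fun u' : ℝ => (u', v)).continuousAt.eventually
      (ho.mem_nhds hp)).mono fun u' hu' => EventuallyEq.deriv_eq (hr u' v hu')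
  · rw [hv u v hp]
    refine (hH.deriv_v_deriv_u u v hp).congr_of_eventuallyEq ?_
    exact ((by fun_prop : Continuous fun v' : ℝ => (u, v')).continuousAt.eventually
      (ho.mem_nhds hp)).mono fun v' hv' => EventuallyEq.deriv_eq (hl u v' hv')
  · have h0 : (u, (0 : ℝ)) ∈ charDomain a := ⟨by simp, by simpa using abs_le.2 hu⟩
    rw [show H' u 0 = H u 0 from he h0, hH.on_u_axis u hu]
    congr 2
    refine integral_congr fun s hs => (hq ?_).symm
    exact uIcc_subset_Icc ⟨by linarith [hu.1, hu.2], by linarith [hu.1, hu.2]⟩ hu hs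
  · have h0 : ((0 : ℝ), v) ∈ charDomain a := ⟨by simp, by simpa using abs_le.2 hv⟩
    rw [show H' 0 v = H 0 v from he h0, hH.on_v_axis v hv]

/-- G is C¹ for merely continuous q and K, and its first partials are, up to a function of u alone,
primitives in the other variable. Hence both mixed derivatives exist without second-order
regularity. -/
theorem SolvesIntegralEquation.solvesCharGoursat (hI : SolvesIntegralEquation a q h K)
    (hq : Continuous q) (hK : Continuous (uncurry K)) :
    SolvesCharGoursat a q h fun u v => K (u + v) (u - v) := by
  have hG := contDiff_goursatIntegral (h := h) hq hK
  have hF := continuous_goursat_source hq hK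
  refine SolvesCharGoursat.congr (H := goursatIntegral q h K) (q := q) ?_ (fun _ _ => rfl)
    (fun p hp => hI p.1 p.2 hp)
  refine ⟨hG.continuous.continuousOn, hG.contDiffOn, fun u v hp => ?_, fun u v hp => ?_,
    fun u _ => ?_, fun v _ => ?_⟩
  · rw [← hI u v (charInterior_subset a hp)]
    simp only [fun u v => (hasDerivAt_goursatIntegral_right (h := h) hq hK u v).deriv]
    exact hasDerivAt_primitive (continuous_left hF v) u
  · rw [← hI u v (charInterior_subset a hp)]
    simp only [fun u v => (hasDerivAt_goursatIntegral_left (h := h) hq hK u v).deriv]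
    exact (hasDerivAt_primitive (continuous_right hF u) v).const_add _
  · simp [goursatIntegral]
  · simp [goursatIntegral]

/-- Integration of a mixed derivative that exists in the open unit square. -/
theorem integral_mixed_deriv {g ga φ : ℝ → ℝ → ℂ} (hg : Continuous (uncurry g))
    (hφ : Continuous (uncurry φ))
    (h₁ : ∀ α ∈ Ioo (0 : ℝ) 1, ∀ β ∈ Ioo (0 : ℝ) 1, HasDerivAt (fun α => g α β) (ga α β) α)
    (h₂ : ∀ α ∈ Ioo (0 : ℝ) 1, ∀ β ∈ Ioo (0 : ℝ) 1, HasDerivAt (fun β => ga α β) (φ α β) β) :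
    (∫ α in (0 : ℝ)..1, ∫ β in (0 : ℝ)..1, φ α β) = g 1 1 - g 1 0 - (g 0 1 - g 0 0) := by
  have cJ : Continuous fun p : ℝ × ℝ => ∫ β in p.1..1 - p.1, φ p.2 β :=
    continuous_integral_bounds (F := fun (p : ℝ × ℝ) β => φ p.2 β)
      (hφ.comp (by fun_prop : Continuous fun r : (ℝ × ℝ) × ℝ => (r.1.2, r.2)))
      (by fun_prop) (by fun_prop)
  have cL : Continuous fun ε => ∫ α in (0 : ℝ)..1, ∫ β in ε..1 - ε, φ α β :=
    continuous_integral_bounds cJ continuous_const continuous_const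
  have cR : Continuous fun ε => g 1 (1 - ε) - g 1 ε - (g 0 (1 - ε) - g 0 ε) :=
    ((continuous_apply₂ hg (by fun_prop) (by fun_prop)).sub
      (continuous_apply₂ hg (by fun_prop) (by fun_prop))).sub
      ((continuous_apply₂ hg (by fun_prop) (by fun_prop)).sub
      (continuous_apply₂ hg (by fun_prop) (by fun_prop)))
  -- The derivatives exist only inside the square. Truncating β to [ε,1-ε] keeps `ga` away from the
  -- edges β = 0, 1; in α, continuity of g up to the ends is enough. Then ε → 0.
  have he : EqOn (fun ε => ∫ α in (0 : ℝ)..1, ∫ β in ε..1 - ε, φ α β)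
      (fun ε => g 1 (1 - ε) - g 1 ε - (g 0 (1 - ε) - g 0 ε)) (Ioo 0 (1 / 2)) := by
    intro ε hε
    have m₀ : ε ∈ Ioo (0 : ℝ) 1 := ⟨hε.1, by linarith [hε.2]⟩
    have m₁ : 1 - ε ∈ Ioo (0 : ℝ) 1 := ⟨by linarith [hε.2], by linarith [hε.1]⟩
    have hin : ∀ α ∈ Ioo (0 : ℝ) 1, (∫ β in ε..1 - ε, φ α β) = ga α (1 - ε) - ga α ε :=
      fun α hα => integral_eq_sub_of_hasDerivAt
        (fun β hβ => h₂ α hα β (ordConnected_Ioo.uIcc_subset m₀ m₁ hβ))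
        ((continuous_right hφ α).intervalIntegrable _ _)
    have cα : Continuous fun α => ∫ β in ε..1 - ε, φ α β :=
      cJ.comp (by fun_prop : Continuous fun α : ℝ => (ε, α))
    have := integral_eq_sub_of_hasDerivAt_of_le zero_le_one
      (f := fun α => g α (1 - ε) - g α ε)
      (((continuous_left hg _).sub (continuous_left hg _)).continuousOn)
      (fun α hα => ((h₁ α hα _ m₁).fun_sub (h₁ α hα _ m₀)).congr_deriv (hin α hα).symm)
      (cα.intervalIntegrable _ _)
    simpa using this
  have := he.closure cL cR
  rw [closure_Ioo (by norm_num)] at this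
  simpa using this (left_mem_Icc.2 (by norm_num))

/-- Integrate one mixed derivative over the rectangle with opposite corners 0 and (u,v); the axis
data supply three corner values. Rescaling to the unit square treats both signs of u, v at once. -/
theorem SolvesCharGoursat.solvesIntegralEquation
    (hH : SolvesCharGoursat a q h fun u v => K (u + v) (u - v))
    (hq : Continuous q) (hK : Continuous (uncurry K)) : SolvesIntegralEquation a q h K := by
  intro u v hp
  have hF := continuous_goursat_source hq hK
  have cH : Continuous (uncurry fun u v => K (u + v) (u - v)) :=
    hK.comp (by fun_prop : Continuous fun p : ℝ × ℝ => (p.1 + p.2, p.1 - p.2))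
  have hp1 : 0 ≤ u * v := hp.1
  have hp2 : |u + v| ≤ a := hp.2
  have hu : u ∈ Icc (-a) a ∧ v ∈ Icc (-a) a := by
    rw [mem_Icc, mem_Icc, ← abs_le, ← abs_le]
    constructor <;> refine le_trans (sq_le_sq.1 ?_) hp2 <;> nlinarith [sq_nonneg u, sq_nonneg v]
  have m0 : (0 : ℝ) ∈ Icc (-a) a := by
    have := (abs_nonneg _).trans hp2
    exact ⟨by linarith, this⟩
  rcases hp1.eq_or_lt with h0 | h0
  · rcases mul_eq_zero.1 h0.symm with h0 | h0
    · subst h0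
      simpa [goursatIntegral] using hH.on_v_axis v hu.2
    · subst h0
      simpa [goursatIntegral] using hH.on_u_axis u hu.1
  have mem : ∀ α ∈ Ioo (0 : ℝ) 1, ∀ β ∈ Ioo (0 : ℝ) 1, (α * u, β * v) ∈ charInterior a := by
    intro α hα β hβ
    have e : α * u * (β * v) = α * β * (u * v) := by ring
    have hαβ : 0 < α * β := mul_pos hα.1 hβ.1
    refine ⟨show 0 < α * u * (β * v) by rw [e]; positivity, lt_of_lt_of_le (sq_lt_sq.1 ?_) hp2⟩
    have h1 : α * β < 1 := mul_lt_one_of_nonneg_of_lt_one_left hα.1.le hα.2 hβ.2.le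
    have hu0 : 0 < u ^ 2 := by
      have : u ≠ 0 := by rintro rfl; simp at h0
      positivity
    have h2 : α ^ 2 * u ^ 2 < u ^ 2 := by
      have : α ^ 2 < 1 := by nlinarith [hα.1, hα.2]
      nlinarith
    have h3 : β ^ 2 * v ^ 2 ≤ v ^ 2 := by
      have : β ^ 2 < 1 := by nlinarith [hβ.1, hβ.2]
      nlinarith [sq_nonneg v]
    show (α * u + β * v) ^ 2 < (u + v) ^ 2
    nlinarith
  have hd : ∀ α ∈ Ioo (0 : ℝ) 1, ∀ β ∈ Ioo (0 : ℝ) 1,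
      DifferentiableAt ℝ (fun u' => K (u' + β * v) (u' - β * v)) (α * u) := by
    intro α hα β hβ
    have h1 := (hH.contDiffOn.contDiffAt ((isOpen_charInterior a).mem_nhds
      (mem α hα β hβ))).differentiableAt one_ne_zero
    exact h1.comp (f := fun u' : ℝ => (u', β * v)) (α * u) (by fun_prop)
  have main := integral_mixed_deriv
    (g := fun α β => K (α * u + β * v) (α * u - β * v))
    (ga := fun α β => u * deriv (fun u' => K (u' + β * v) (u' - β * v)) (α * u))
    (φ := fun α β => u * (v * (q (α * u + β * v) * K (α * u + β * v) (α * u - β * v))))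
    (continuous_apply₂ hK (by fun_prop) (by fun_prop))
    (continuous_const.mul (continuous_const.mul
      ((hq.comp (by fun_prop : Continuous fun p : ℝ × ℝ => p.1 * u + p.2 * v)).mul
      (continuous_apply₂ hK (by fun_prop) (by fun_prop)))))
    (fun α hα β hβ => by
      have := (hd α hα β hβ).hasDerivAt.scomp α ((hasDerivAt_id α).mul_const u)
      simpa [comp_def] using this)
    (fun α hα β hβ => by
      have := (hH.deriv_v_deriv_u _ _ (mem α hα β hβ)).scomp β ((hasDerivAt_id β).mul_const v)
      simpa [comp_def] using this.const_mul (u : ℂ))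
  have e : (∫ α in (0 : ℝ)..1, ∫ β in (0 : ℝ)..1,
      u * (v * (q (α * u + β * v) * K (α * u + β * v) (α * u - β * v)))) =
      ∫ s in (0 : ℝ)..u, ∫ r in (0 : ℝ)..v, q (s + r) * K (s + r) (s - r) := by
    have e₁ : ∀ s : ℝ, (v : ℂ) * ∫ β in (0 : ℝ)..1, q (s + β * v) * K (s + β * v) (s - β * v) =
        ∫ r in (0 : ℝ)..v, q (s + r) * K (s + r) (s - r) := fun s => by
      simpa using smul_integral_comp_mul_right (a := 0) (b := 1)
        (fun r => q (s + r) * K (s + r) (s - r)) v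
    simp only [intervalIntegral.integral_const_mul, e₁]
    simpa using smul_integral_comp_mul_right (a := 0) (b := 1)
      (fun s => ∫ r in (0 : ℝ)..v, q (s + r) * K (s + r) (s - r)) u
  have b₁ := hH.on_u_axis u hu.1
  have b₂ := hH.on_v_axis v hu.2
  have b₃ := hH.on_v_axis 0 m0
  simp only [e, one_mul, zero_mul, add_zero, sub_zero, zero_add, zero_sub] at main b₁ b₂ b₃
  rw [b₁, b₂, b₃] at main
  rw [goursatIntegral, main]
  ring

/-! ### Insensitivity to values off the domain; proof of (M) -/

theorem mem_kernelDomain_of_mem_uIoc {x t : ℝ} (hx : x ∈ Icc (-a) a) (ht : t ∈ uIoc (-x) x) :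
    (x, t) ∈ kernelDomain a :=
  ⟨abs_le_of_mem_uIoc_neg ht, abs_le.2 hx⟩

theorem volterra_congr {f g : ℝ → ℂ} (hK : EqOn (uncurry K) (uncurry K') (kernelDomain a))
    (hf : EqOn f g (Icc (-a) a)) {x : ℝ} (hx : x ∈ Icc (-a) a) :
    volterra K f x = volterra K' g x := by
  rw [volterra, volterra, hf hx]
  congr 1
  refine integral_congr_ae (Eventually.of_forall fun t ht => ?_)
  have hm := mem_kernelDomain_of_mem_uIoc hx ht
  rw [show K x t = K' x t from hK hm, hf (abs_le.1 (hm.1.trans hm.2))]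

theorem IsSolution.congr {p p' u u' u₁ : ℝ → ℂ} (hs : IsSolution a p u u₁)
    (hp : EqOn p' p (Icc (-a) a)) (hu : EqOn u' u (Icc (-a) a)) : IsSolution a p' u' u₁ :=
  fun x hx => ⟨(hs x hx).1.congr_of_mem hu hx, by rw [hp hx, hu hx]; exact (hs x hx).2⟩

theorem MapsSolutions.congr (hM : MapsSolutions a q h K)
    (hq : EqOn q' q (Icc (-a) a)) (hK : EqOn (uncurry K') (uncurry K) (kernelDomain a)) :
    MapsSolutions a q' h K' := by
  refine ⟨hM.1.congr hK, fun ω v v₁ hv => ?_⟩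
  obtain ⟨u₁, h1, h2, h3⟩ := hM.2 ω v v₁ hv
  exact ⟨u₁, h1.congr (fun x hx => by simp only [hq hx])
    (fun x hx => volterra_congr hK (fun _ _ => rfl) hx), volterra_zero _ _, h3⟩

theorem VolterraIsTransmutation.congr {hab : -a ≤ a} (hT : VolterraIsTransmutation hab q K)
    (hq : EqOn q' q (Icc (-a) a)) (hK : EqOn (uncurry K') (uncurry K) (kernelDomain a)) :
    VolterraIsTransmutation hab q' K' := by
  obtain ⟨T, h1, h2⟩ := hT
  refine ⟨T, fun u x => ?_, fun u u₂ hu => ?_⟩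
  · rw [h1, volterra_congr hK (fun _ _ => rfl) x.2]
  · obtain ⟨w₂, hw, he⟩ := h2 u u₂ hu
    exact ⟨w₂, hw, fun x => by rw [hq x.2, he]⟩

theorem SolvesIntegralEquation.mapsSolutions (ha : 0 ≤ a) (hI : SolvesIntegralEquation a q h K)
    (hq : Continuous q) (hK : Continuous (uncurry K)) : MapsSolutions a q h K := by
  refine ⟨hK.continuousOn, fun ω v v₁ hv => ?_⟩
  have m0 : (0 : ℝ) ∈ Icc (-a) a := ⟨by linarith, ha⟩
  have cv : ContinuousOn v (Icc (-a) a) := fun x hx => (hv x hx).1.continuousWithinAt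
  obtain ⟨f, f₁, f₂, d, d₁, c₂, e, e₁, e₂⟩ := exists_extension_twice_differentiable ha
    (fun x hx => (hv x hx).1) (fun x hx => (hv x hx).2) (continuousOn_const.mul cv)
  have hf : EqOn (volterra K v) (volterra K f) (Icc (-a) a) := fun x hx =>
    volterra_congr (fun _ _ => rfl) e.symm hx
  refine ⟨fun x => f₁ x + h / 2 * (f x + f (-x)) + duhamelAdd q K f x, fun x hx => ?_,
    volterra_zero _ _, ?_⟩
  · have hi := hI.intertwines hq hK d d₁ c₂ hx
    refine ⟨hi.1.congr_of_mem hf hx, hi.2.congr_deriv ?_⟩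
    have : volterra K f₂ x = -ω ^ 2 * volterra K v x := by
      rw [volterra_congr (K' := K) (fun _ _ => rfl) e₂ hx]
      simp only [volterra, mul_left_comm _ (-ω ^ 2), intervalIntegral.integral_const_mul, mul_add]
    rw [this, hf hx]
    ring
  · simp only [duhamelAdd, integral_same, neg_zero, e m0, e₁ m0]
    ring

/-! ### Invertibility and the transmutation property -/

/-- The integral part of the Volterra operator on `C[-a, a]`. -/
def volterraIntegral (hab : -a ≤ a) (hK : Continuous (uncurry K)) :
    C(Icc (-a) a, ℂ) →ₗ[ℂ] C(Icc (-a) a, ℂ) where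
  toFun u := ⟨fun x => ∫ t in (-x : ℝ)..x, K x t * IccExtend hab u t,
    continuous_integral_bounds (F := fun (x : Icc (-a) a) t => K x t * IccExtend hab u t)
      ((hK.comp (by fun_prop : Continuous fun p : Icc (-a) a × ℝ => ((p.1 : ℝ), p.2))).mul
        (u.continuous.Icc_extend'.comp continuous_snd)) (by fun_prop) (by fun_prop)⟩
  map_add' u w := by
    ext x
    have hc : ∀ u : C(Icc (-a) a, ℂ), Continuous fun t => K x t * IccExtend hab u t := fun u =>
      (continuous_right hK x).mul u.continuous.Icc_extend'
    simp only [ContinuousMap.coe_mk, ContinuousMap.add_apply]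
    rw [← intervalIntegral.integral_add ((hc u).intervalIntegrable _ _)
      ((hc w).intervalIntegrable _ _)]
    congr 1 with t
    simp [IccExtend, mul_add]
  map_smul' c u := by
    ext x
    simp only [ContinuousMap.coe_mk, ContinuousMap.smul_apply, RingHom.id_apply, smul_eq_mul,
      ← intervalIntegral.integral_const_mul]
    congr 1 with t
    simp [IccExtend, mul_left_comm]

theorem volterraIntegral_apply (hab : -a ≤ a) (hK : Continuous (uncurry K))
    (u : C(Icc (-a) a, ℂ)) (x : Icc (-a) a) :
    volterraIntegral hab hK u x = ∫ t in (-x : ℝ)..x, K x t * IccExtend hab u t := rfl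

theorem exists_bound_kernel (a : ℝ) (hK : Continuous (uncurry K)) :
    ∃ M, 0 ≤ M ∧ ∀ x t, x ∈ Icc (-a) a → |t| ≤ |x| → ‖K x t‖ ≤ M := by
  obtain ⟨M, hM⟩ := ((isCompact_Icc (a := -a) (b := a)).prod
    (isCompact_Icc (a := -a) (b := a))).exists_bound_of_continuousOn hK.continuousOn
  exact ⟨max M 0, le_max_right _ _, fun x t hx ht => (hM (x, t) ⟨hx, abs_le.1
    (ht.trans (abs_le.2 hx))⟩).trans (le_max_left _ _)⟩

/-- A weighted bound for the integral part of the Volterra operator. -/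
theorem norm_volterraIntegral_le (hab : -a ≤ a) (hK : Continuous (uncurry K)) {M : ℝ}
    (hM : ∀ x t, x ∈ Icc (-a) a → |t| ≤ |x| → ‖K x t‖ ≤ M) (hM0 : 0 ≤ M) {l : ℝ} (hl : 0 < l)
    {u : C(Icc (-a) a, ℂ)} {C : ℝ} (hC : 0 ≤ C)
    (hu : ∀ t : Icc (-a) a, ‖u t‖ ≤ C * Real.cosh (l * t)) (x : Icc (-a) a) :
    ‖volterraIntegral hab hK u x‖ ≤ 2 * M / l * C * Real.cosh (l * x) := by
  rw [volterraIntegral_apply]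
  have hd : ∀ t : ℝ, HasDerivAt (fun t => Real.sinh (l * t) / l) (Real.cosh (l * t)) t := fun t => by
    refine ((((hasDerivAt_id t).const_mul l).sinh).div_const l).congr_deriv ?_
    simp [hl.ne']
  -- The weight cosh(lt) gains a factor 1/l on integration, and |sinh| ≤ cosh returns the weight.
  have hi : (∫ t in (-x : ℝ)..x, M * (C * Real.cosh (l * t))) =
      2 * M / l * C * Real.sinh (l * x) := by
    rw [intervalIntegral.integral_const_mul, intervalIntegral.integral_const_mul,
      integral_eq_sub_of_hasDerivAt (fun t _ => hd t)
        (Continuous.intervalIntegrable (by fun_prop) _ _), mul_neg, Real.sinh_neg]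
    field_simp
    ring
  refine (norm_integral_le_abs_of_norm_le (g := fun t => M * (C * Real.cosh (l * t)))
    (ae_restrict_of_forall_mem measurableSet_uIoc fun t ht => ?_)
    (Continuous.intervalIntegrable (by fun_prop) _ _)).trans ?_
  · have hm := mem_kernelDomain_of_mem_uIoc x.2 ht
    have htm : t ∈ Icc (-a) a := abs_le.1 (hm.1.trans hm.2)
    rw [norm_mul, IccExtend_of_mem hab _ htm]
    exact mul_le_mul (hM _ _ x.2 hm.1) (hu ⟨t, htm⟩) (norm_nonneg _) hM0
  · rw [hi, abs_mul, abs_of_nonneg (by positivity : 0 ≤ 2 * M / l * C)]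
    refine mul_le_mul_of_nonneg_left ?_ (by positivity)
    rw [← Real.cosh_abs, Real.abs_sinh]
    exact (Real.sinh_lt_cosh _).le

/-- A linear operator on `C(X)` that contracts some weighted supremum norm can be inverted after
adding the identity. -/
theorem isUnit_one_add_of_weighted_bound {X : Type*} [TopologicalSpace X] [CompactSpace X]
    (V : C(X, ℂ) →L[ℂ] C(X, ℂ)) (w : C(X, ℝ)) (hw : ∀ x, 0 < w x) {c : ℝ} (hc0 : 0 ≤ c)
    (hc : c < 1)
    (hV : ∀ (u : C(X, ℂ)) (C : ℝ), 0 ≤ C → (∀ x, ‖u x‖ ≤ C * w x) → ∀ x, ‖V u x‖ ≤ c * C * w x) :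
    IsUnit (1 + V) := by
  have hw' : ∀ x, (w x : ℂ) ≠ 0 := fun x => Complex.ofReal_ne_zero.2 (hw x).ne'
  let W : C(X, ℂ) := ⟨fun x => w x, by fun_prop⟩
  let W' : C(X, ℂ) := ⟨fun x => (w x : ℂ)⁻¹, Continuous.inv₀ (by fun_prop) hw'⟩
  have hWW' : W * W' = 1 := by ext x; exact mul_inv_cancel₀ (hw' x)
  let A : C(X, ℂ) →L[ℂ] C(X, ℂ) := ContinuousLinearMap.mul ℂ C(X, ℂ) W
  let B : C(X, ℂ) →L[ℂ] C(X, ℂ) := ContinuousLinearMap.mul ℂ C(X, ℂ) W'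
  have hAB : A * B = 1 := by
    ext1 u
    show W * (W' * u) = u
    rw [← mul_assoc, hWW', one_mul]
  have hBA : B * A = 1 := by
    ext1 u
    show W' * (W * u) = u
    rw [← mul_assoc, mul_comm W', hWW', one_mul]
  -- Conjugation by multiplication with w turns the weighted norm into the sup norm, where the
  -- Neumann series applies.
  let U : (C(X, ℂ) →L[ℂ] C(X, ℂ))ˣ := ⟨A, B, hAB, hBA⟩
  have hn : ‖-(B * V * A)‖ < 1 := by
    rw [norm_neg]
    refine lt_of_le_of_lt (ContinuousLinearMap.opNorm_le_bound _ hc0 fun u => ?_) hc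
    refine (ContinuousMap.norm_le _ (by positivity)).2 fun x => ?_
    show ‖(w x : ℂ)⁻¹ * V (W * u) x‖ ≤ _
    have hb := hV (W * u) ‖u‖ (norm_nonneg _) (fun x => by
      show ‖(w x : ℂ) * u x‖ ≤ _
      rw [norm_mul, Complex.norm_real, Real.norm_of_nonneg (hw x).le, mul_comm]
      exact mul_le_mul_of_nonneg_right (u.norm_coe_le_norm x) (hw x).le) x
    rw [norm_mul, norm_inv, Complex.norm_real, Real.norm_of_nonneg (hw x).le, inv_mul_le_iff₀ (hw x)]
    linarith
  have h1 : IsUnit (1 + B * V * A) := by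
    simpa using isUnit_one_sub_of_norm_lt_one (x := -(B * V * A)) hn
  have e : 1 + V = U * (1 + B * V * A) * (U⁻¹ : (C(X, ℂ) →L[ℂ] C(X, ℂ))ˣ) := by
    show 1 + V = A * (1 + B * V * A) * B
    calc 1 + V = A * B + (A * B) * V * (A * B) := by rw [hAB]; simp
      _ = A * (1 + B * V * A) * B := by noncomm_ring
  rw [e]
  exact (U.isUnit.mul h1).mul U⁻¹.isUnit

theorem exists_volterra_equiv (hab : -a ≤ a) (hK : Continuous (uncurry K)) :
    ∃ T : C(Icc (-a) a, ℂ) ≃L[ℂ] C(Icc (-a) a, ℂ),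
      ∀ (u : C(Icc (-a) a, ℂ)) (x : Icc (-a) a), T u x = volterra K (IccExtend hab u) x := by
  obtain ⟨M, hM0, hM⟩ := exists_bound_kernel a hK
  have ha : 0 ≤ a := by linarith
  let V : C(Icc (-a) a, ℂ) →L[ℂ] C(Icc (-a) a, ℂ) :=
    (volterraIntegral hab hK).mkContinuous (2 * M * Real.cosh a) fun u => by
      refine (ContinuousMap.norm_le _ (by positivity)).2 fun x => ?_
      have h1 := norm_volterraIntegral_le hab hK hM hM0 one_pos (norm_nonneg u) (fun t => by
        exact (u.norm_coe_le_norm t).trans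
          (le_mul_of_one_le_right (norm_nonneg _) (Real.one_le_cosh _))) x
      have h2 : Real.cosh (1 * x) ≤ Real.cosh a := by
        rw [one_mul, Real.cosh_le_cosh, abs_of_nonneg ha]
        exact abs_le.2 x.2
      calc _ ≤ _ := h1
        _ ≤ 2 * M / 1 * ‖u‖ * Real.cosh a := by gcongr
        _ = _ := by ring
  have hu : IsUnit (1 + V) := by
    -- With l = 4(M+1) the contraction factor 2M/l is below 1, and l > 0 even if M = 0.
    refine isUnit_one_add_of_weighted_bound V
      ⟨fun x => Real.cosh (4 * (M + 1) * x), by fun_prop⟩ (fun x => Real.cosh_pos _)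
      (c := 2 * M / (4 * (M + 1))) (by positivity) ?_ fun u C hC hu x => ?_
    · rw [div_lt_one (by positivity)]
      linarith
    · exact norm_volterraIntegral_le hab hK hM hM0 (by positivity) hC hu x
  refine ⟨ContinuousLinearEquiv.unitsEquiv ℂ _ hu.unit, fun u x => ?_⟩
  show u x + volterraIntegral hab hK u x = _
  rw [volterraIntegral_apply, volterra, IccExtend_of_mem hab _ x.2]

theorem SolvesIntegralEquation.volterraIsTransmutation (hab : -a ≤ a)
    (hI : SolvesIntegralEquation a q h K) (hq : Continuous q) (hK : Continuous (uncurry K)) :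
    VolterraIsTransmutation hab q K := by
  have ha : 0 ≤ a := by linarith
  obtain ⟨T, hT⟩ := exists_volterra_equiv hab hK
  refine ⟨T, hT, fun u u₂ ⟨u₁, hu⟩ => ?_⟩
  obtain ⟨f, f₁, f₂, d, d₁, c₂, e, -, e₂⟩ := exists_extension_twice_differentiable ha
    (v := IccExtend hab u) (v₁ := IccExtend hab u₁) (v₂ := IccExtend hab u₂)
    (fun x hx => by rw [IccExtend_of_mem hab _ hx]; exact (hu ⟨x, hx⟩).1)
    (fun x hx => by rw [IccExtend_of_mem hab _ hx]; exact (hu ⟨x, hx⟩).2)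
    u₂.continuous.Icc_extend'.continuousOn
  have cf : Continuous f := continuous_iff_continuousAt.2 fun x => (d x).continuousAt
  let w₁ : ℝ → ℂ := fun x => f₁ x + h / 2 * (f x + f (-x)) + duhamelAdd q K f x
  have hw₁ : Continuous w₁ := continuous_iff_continuousAt.2 fun x =>
    (hasDerivAt_duhamel (h := h) hq hK (hasDerivAt_primitive cf) d d₁ x).2.continuousAt
  have hTf : ∀ x : Icc (-a) a, T u x = volterra K f x := fun x => by
    rw [hT, volterra_congr (K' := K) (fun _ _ => rfl) e x.2]
  have hTf₂ : ∀ x : Icc (-a) a, T u₂ x = volterra K f₂ x := fun x => by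
    rw [hT, volterra_congr (K' := K) (fun _ _ => rfl) e₂ x.2]
  refine ⟨⟨fun x => q x * T u x + T u₂ x, by fun_prop⟩, ⟨⟨fun x => w₁ x, by fun_prop⟩, fun x => ?_⟩,
    fun x => ?_⟩
  · have hi := hI.intertwines hq hK d d₁ c₂ x.2
    refine ⟨hi.1.congr_of_mem (fun y hy => ?_) x.2,
      (hi.2.congr_of_mem (fun y hy => IccExtend_of_mem hab _ hy) x.2).congr_deriv ?_⟩
    · rw [IccExtend_of_mem hab _ hy, hTf]
    · rw [ContinuousMap.coe_mk, hTf, hTf₂]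
  · rw [map_neg, ContinuousMap.neg_apply, ContinuousMap.coe_mk]
    ring

/-! ### Change of coordinates and extensions -/

theorem isOpen_kernelInterior (a : ℝ) : IsOpen (kernelInterior a) :=
  (isOpen_lt (by fun_prop : Continuous fun p : ℝ × ℝ => |p.2|)
    (by fun_prop : Continuous fun p : ℝ × ℝ => |p.1|)).inter
    (isOpen_lt (by fun_prop : Continuous fun p : ℝ × ℝ => |p.1|) continuous_const)

theorem char_mem_kernelInterior {u v : ℝ} (hp : (u, v) ∈ charInterior a) :
    (u + v, u - v) ∈ kernelInterior a :=
  ⟨sq_lt_sq.1 (by have h1 : 0 < u * v := hp.1; show (u - v) ^ 2 < (u + v) ^ 2; nlinarith), hp.2⟩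

theorem char_mem_charInterior {x t : ℝ} (hp : (x, t) ∈ kernelInterior a) :
    ((x + t) / 2, (x - t) / 2) ∈ charInterior a := by
  have := sq_lt_sq.2 hp.1
  refine ⟨?_, ?_⟩
  · show 0 < (x + t) / 2 * ((x - t) / 2)
    dsimp only at this
    nlinarith
  · show |(x + t) / 2 + (x - t) / 2| < a
    rw [← add_div, add_add_sub_cancel, add_self_div_two]
    exact hp.2

theorem uncurry_eq_char (K : ℝ → ℝ → ℂ) :
    uncurry K = uncurry (fun u v => K (u + v) (u - v)) ∘
      fun p : ℝ × ℝ => ((p.1 + p.2) / 2, (p.1 - p.2) / 2) := by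
  funext p
  show K p.1 p.2 = K ((p.1 + p.2) / 2 + (p.1 - p.2) / 2) ((p.1 + p.2) / 2 - (p.1 - p.2) / 2)
  ring_nf

theorem continuousOn_kernel_of_char
    (hc : ContinuousOn (uncurry fun u v => K (u + v) (u - v)) (charDomain a)) :
    ContinuousOn (uncurry K) (kernelDomain a) := by
  rw [uncurry_eq_char]
  exact hc.comp (by fun_prop) fun p hp => char_mem_charDomain hp.2 hp.1

theorem continuousOn_char_of_kernel (hc : ContinuousOn (uncurry K) (kernelDomain a)) :
    ContinuousOn (uncurry fun u v => K (u + v) (u - v)) (charDomain a) :=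
  hc.comp (by fun_prop : ContinuousOn (fun p : ℝ × ℝ => (p.1 + p.2, p.1 - p.2)) _)
    fun _ hp => char_mem_kernelDomain hp

/-- Tietze's theorem on the closed domain; the integral calculus can then be carried out on the
whole plane. -/
theorem exists_continuous_extension_kernel (hc : ContinuousOn (uncurry K) (kernelDomain a)) :
    ∃ K' : ℝ → ℝ → ℂ, Continuous (uncurry K') ∧
      EqOn (uncurry K') (uncurry K) (kernelDomain a) := by
  obtain ⟨g, hg⟩ := ContinuousMap.exists_restrict_eq (isClosed_kernelDomain a)
    ⟨(kernelDomain a).domRestrict (uncurry K), hc.domRestrict⟩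
  exact ⟨fun x t => g (x, t), g.continuous, fun p hp => DFunLike.congr_fun hg ⟨p, hp⟩⟩

theorem exists_contDiff_extension (ha : 0 < a) (hq : ContDiffOn ℝ 1 q (Icc (-a) a)) :
    ∃ q' : ℝ → ℂ, ContDiff ℝ 1 q' ∧ EqOn q' q (Icc (-a) a) := by
  have hu : UniqueDiffOn ℝ (Icc (-a) a) := uniqueDiffOn_Icc (by linarith)
  obtain ⟨f₁, c₁, e₁⟩ := exists_continuous_extension_Icc ha.le
    (hq.continuousOn_derivWithin hu le_rfl)
  obtain ⟨f, d, e⟩ := exists_extension_of_hasDerivWithinAt ha.le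
    (fun x hx => ((hq.differentiableOn one_ne_zero) x hx).hasDerivWithinAt) c₁ e₁
  refine ⟨f, contDiff_one_iff_deriv.2 ⟨fun x => (d x).differentiableAt, ?_⟩, e⟩
  rwa [show deriv f = f₁ from funext fun x => (d x).deriv]

/-! ### C² regularity for C¹ potentials -/

theorem contDiff_one_primitive {F : ℝ → ℝ → ℂ} (hF : ContDiff ℝ 1 (uncurry F)) :
    ContDiff ℝ 1 (uncurry fun u v => ∫ r in (0 : ℝ)..v, F u r) := by
  have cF' : Continuous (uncurry fun u r => fderiv ℝ (uncurry F) (u, r) (1, 0)) :=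
    (hF.continuous_fderiv one_ne_zero).clm_apply continuous_const
  have dF : ∀ u r, HasDerivAt (fun u => F u r) (fderiv ℝ (uncurry F) (u, r) (1, 0)) u := fun u r =>
    ((hF.differentiable one_ne_zero) (u, r)).hasFDerivAt.comp_hasDerivAt
      (f := fun u : ℝ => (u, r)) u ((hasDerivAt_id u).prodMk (hasDerivAt_const u r))
  exact contDiff_one_of_continuous_partials (continuous_primitive cF') hF.continuous
    (fun u v => hasDerivAt_integral_of_continuous hF.continuous cF' dF 0 v u)
    (fun u v => hasDerivAt_primitive (continuous_right hF.continuous u) v)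

/-- The integrals in the first partials of G run along sides of this rectangle, so K may be replaced
by G there. -/
theorem rect_subset_charDomain {u v s r : ℝ} (hp : (u, v) ∈ charDomain a) (hs : s ∈ uIcc 0 u)
    (hr : r ∈ uIcc 0 v) : (s, r) ∈ charDomain a := by
  have h1 : 0 ≤ u * v := hp.1
  have h2 := abs_le.1 (show |u + v| ≤ a from hp.2)
  rw [mem_uIcc] at hs hr
  have : (0 ≤ s ∧ 0 ≤ r ∧ s + r ≤ a) ∨ (s ≤ 0 ∧ r ≤ 0 ∧ -a ≤ s + r) := by
    rcases mul_nonneg_iff.1 h1 with h | h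
    · left
      refine ⟨?_, ?_, ?_⟩ <;> rcases hs with hs | hs <;> rcases hr with hr | hr <;> linarith
    · right
      refine ⟨?_, ?_, ?_⟩ <;> rcases hs with hs | hs <;> rcases hr with hr | hr <;> linarith
  rcases this with ⟨h3, h4, h5⟩ | ⟨h3, h4, h5⟩
  · exact ⟨mul_nonneg h3 h4, abs_le.2 ⟨by dsimp only; linarith, h5⟩⟩
  · exact ⟨mul_nonneg_of_nonpos_of_nonpos h3 h4, abs_le.2 ⟨h5, by dsimp only; linarith⟩⟩

/-- A bootstrap: G is already C¹, so after K is replaced by G in its first partials the integrands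
are C¹, and so are the partials. -/
theorem SolvesIntegralEquation.contDiffOn_two (hI : SolvesIntegralEquation a q h K)
    (hq : ContDiff ℝ 1 q) (hK : Continuous (uncurry K)) :
    ContDiffOn ℝ 2 (uncurry (goursatIntegral q h K)) (charInterior a) := by
  have hqc := hq.continuous
  have ho := isOpen_charInterior a
  have hG := contDiff_goursatIntegral (h := h) hqc hK
  have hS : ContDiff ℝ 1 (uncurry fun u r => q (u + r) * goursatIntegral q h K u r) :=
    (hq.comp (by fun_prop : ContDiff ℝ 1 fun p : ℝ × ℝ => p.1 + p.2)).mul hG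
  have hSs : ContDiff ℝ 1 (uncurry fun v s => q (s + v) * goursatIntegral q h K s v) :=
    hS.comp (by fun_prop : ContDiff ℝ 1 fun p : ℝ × ℝ => (p.2, p.1))
  have hl : ContDiffOn ℝ 1 (uncurry fun u v =>
      (1 / 2) * q u + ∫ r in (0 : ℝ)..v, q (u + r) * K (u + r) (u - r)) (charInterior a) := by
    refine ContDiffOn.congr (f := fun p : ℝ × ℝ => (1 / 2) * q p.1 +
      ∫ r in (0 : ℝ)..p.2, q (p.1 + r) * goursatIntegral q h K p.1 r)
      (ContDiff.contDiffOn ?_) fun p hp => ?_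
    · exact (contDiff_const.mul (hq.comp contDiff_fst)).add (contDiff_one_primitive hS)
    · simp only [uncurry]
      congr 1
      refine integral_congr fun r hr => ?_
      rw [hI _ _ (rect_subset_charDomain (charInterior_subset a hp) right_mem_uIcc hr)]
  have hr : ContDiffOn ℝ 1 (uncurry fun u v =>
      ∫ s in (0 : ℝ)..u, q (s + v) * K (s + v) (s - v)) (charInterior a) := by
    refine ContDiffOn.congr (f := fun p : ℝ × ℝ =>
      ∫ s in (0 : ℝ)..p.1, q (s + p.2) * goursatIntegral q h K s p.2)
      (ContDiff.contDiffOn ?_) fun p hp => ?_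
    · exact (contDiff_one_primitive hSs).comp
        (by fun_prop : ContDiff ℝ 1 fun p : ℝ × ℝ => (p.2, p.1))
    · simp only [uncurry]
      refine integral_congr fun s hs => ?_
      rw [hI _ _ (rect_subset_charDomain (charInterior_subset a hp) hs right_mem_uIcc)]
  have hd := hasStrictFDerivAt_of_continuous_partials
    (continuous_goursatIntegral_left hqc hK) (continuous_goursatIntegral_right hqc hK)
    (hasDerivAt_goursatIntegral_left (h := h) hqc hK) (hasDerivAt_goursatIntegral_right hqc hK)
  rw [show (2 : WithTop ℕ∞) = 1 + 1 by norm_num, contDiffOn_succ_iff_fderiv_of_isOpen ho]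
  refine ⟨(hG.differentiable one_ne_zero).differentiableOn, by simp, ?_⟩
  rw [show fderiv ℝ (uncurry (goursatIntegral q h K)) = _ from
    funext fun p => (hd p).hasFDerivAt.fderiv]
  have e := (ContinuousLinearMap.toSpanSingletonCLE (𝕜 := ℝ) (E := ℂ)).contDiff (n := 1)
  exact ((e.comp_contDiffOn hl).clm_comp
      (contDiffOn_const (c := ContinuousLinearMap.fst ℝ ℝ ℝ))).add
    ((e.comp_contDiffOn hr).clm_comp (contDiffOn_const (c := ContinuousLinearMap.snd ℝ ℝ ℝ)))

/-! ### Second derivatives and the wave form -/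

section SecondDerivatives

variable {f : ℝ × ℝ → ℂ} {S : Set (ℝ × ℝ)} {γ : ℝ → ℝ × ℝ} {d : ℝ × ℝ}

theorem hasDerivAt_deriv_along (hS : IsOpen S) (hf : ContDiffOn ℝ 2 f S) {s : ℝ}
    (hγ : HasDerivAt γ d s) (hs : γ s ∈ S) (e : ℝ × ℝ) :
    HasDerivAt (fun s => f (γ s)) (fderiv ℝ f (γ s) d) s ∧
      HasDerivAt (fun s => fderiv ℝ f (γ s) e) (fderiv ℝ (fderiv ℝ f) (γ s) d e) s := by
  have hc := hf.contDiffAt (hS.mem_nhds hs)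
  have h1 := (hc.differentiableAt two_ne_zero).hasFDerivAt
  have h2 := ((hc.fderiv_right (m := 1) (by norm_num)).differentiableAt one_ne_zero).hasFDerivAt
  refine ⟨h1.comp_hasDerivAt s hγ, ?_⟩
  simpa using (h2.comp_hasDerivAt s hγ).clm_apply (hasDerivAt_const s e)

theorem iteratedDeriv_two_along (hS : IsOpen S) (hf : ContDiffOn ℝ 2 f S)
    (hγ : ∀ s, HasDerivAt γ d s) {s : ℝ} (hs : γ s ∈ S) :
    iteratedDeriv 2 (fun s => f (γ s)) s = fderiv ℝ (fderiv ℝ f) (γ s) d d := by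
  rw [show (2 : ℕ) = 1 + 1 from rfl, iteratedDeriv_succ, iteratedDeriv_one]
  have he : deriv (fun s => f (γ s)) =ᶠ[𝓝 s] fun s => fderiv ℝ f (γ s) d :=
    ((hγ s).continuousAt.eventually (hS.mem_nhds hs)).mono fun s' hs' =>
      (hasDerivAt_deriv_along hS hf (hγ s') hs' d).1.deriv
  rw [he.deriv_eq, (hasDerivAt_deriv_along hS hf (hγ s) hs d).2.deriv]

end SecondDerivatives

theorem hasDerivAt_add_sub_left (u v : ℝ) :
    HasDerivAt (fun u : ℝ => (u + v, u - v)) ((1 : ℝ), (1 : ℝ)) u :=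
  ((hasDerivAt_id u).add_const v).prodMk ((hasDerivAt_id u).sub_const v)

theorem hasDerivAt_add_sub_right (u v : ℝ) :
    HasDerivAt (fun v : ℝ => (u + v, u - v)) ((1 : ℝ), (-1 : ℝ)) v :=
  ((hasDerivAt_id v).const_add u).prodMk ((hasDerivAt_id v).const_sub u)

/-- Both mixed derivatives in the characteristic coordinates equal `K_{xx} - K_{tt}`. -/
theorem hasDerivAt_mixed_char (hf : ContDiffOn ℝ 2 (uncurry K) (kernelInterior a)) {u v : ℝ}
    (hp : (u, v) ∈ charInterior a) :
    HasDerivAt (fun u' => deriv (fun v' => K (u' + v') (u' - v')) v)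
      (iteratedDeriv 2 (fun x => K x (u - v)) (u + v) -
        iteratedDeriv 2 (fun t => K (u + v) t) (u - v)) u ∧
    HasDerivAt (fun v' => deriv (fun u' => K (u' + v') (u' - v')) u)
      (iteratedDeriv 2 (fun x => K x (u - v)) (u + v) -
        iteratedDeriv 2 (fun t => K (u + v) t) (u - v)) v := by
  have hS := isOpen_kernelInterior a
  have hm := char_mem_kernelInterior hp
  have e₁ := iteratedDeriv_two_along (γ := fun x => (x, u - v)) hS hf
    (fun s => (hasDerivAt_id s).prodMk (hasDerivAt_const s (u - v))) (s := u + v) hm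
  have e₂ := iteratedDeriv_two_along (γ := fun t => (u + v, t)) hS hf
    (fun s => (hasDerivAt_const s (u + v)).prodMk (hasDerivAt_id s)) (s := u - v) hm
  -- Both mixed derivatives are D²K evaluated on (1,1) and (1,-1), in one order or the other.
  -- Symmetry cancels the cross terms, leaving K_xx - K_tt.
  have sym : IsSymmSndFDerivAt ℝ (uncurry K) (u + v, u - v) :=
    (hf.contDiffAt (hS.mem_nhds hm)).isSymmSndFDerivAt (by simp)
  simp only [uncurry_apply_pair] at e₁ e₂
  rw [e₁, e₂]
  have s01 := sym (0, 1) (1, 0)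
  have d1 : ((1 : ℝ), (1 : ℝ)) = (1, 0) + (0, 1) := by simp
  have d2 : ((1 : ℝ), (-1 : ℝ)) = (1, 0) - (0, 1) := by simp
  have hl : ∀ᶠ u' in 𝓝 u, (u' + v, u' - v) ∈ kernelInterior a :=
    (hasDerivAt_add_sub_left u v).continuousAt.eventually (hS.mem_nhds hm)
  have hr : ∀ᶠ v' in 𝓝 v, (u + v', u - v') ∈ kernelInterior a :=
    (hasDerivAt_add_sub_right u v).continuousAt.eventually (hS.mem_nhds hm)
  constructor
  · refine ((hasDerivAt_deriv_along hS hf (hasDerivAt_add_sub_left u v) hm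
      (1, -1)).2.congr_of_eventuallyEq (hl.mono fun u' hu' => ?_)).congr_deriv ?_
    -- The vector 0 is a dummy: only the first-order half of the lemma is used.
    · exact (hasDerivAt_deriv_along hS hf (hasDerivAt_add_sub_right u' v) hu' 0).1.deriv
    · rw [d1, d2]
      simp only [map_add, map_sub, add_apply, s01]
      ring
  · refine ((hasDerivAt_deriv_along hS hf (hasDerivAt_add_sub_right u v) hm
      (1, 1)).2.congr_of_eventuallyEq (hr.mono fun v' hv' => ?_)).congr_deriv ?_
    · exact (hasDerivAt_deriv_along hS hf (hasDerivAt_add_sub_left u v') hv' 0).1.deriv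
    · rw [d1, d2]
      simp only [map_add, map_sub, sub_apply, s01]
      ring

theorem SolvesWaveGoursat.solvesCharGoursat (hW : SolvesWaveGoursat a q h K) :
    SolvesCharGoursat a q h fun u v => K (u + v) (u - v) := by
  have heq : ∀ u v, (u, v) ∈ charInterior a → iteratedDeriv 2 (fun x => K x (u - v)) (u + v) -
      iteratedDeriv 2 (fun t => K (u + v) t) (u - v) = q (u + v) * K (u + v) (u - v) :=
    fun u v hp => by
      rw [← hW.equation _ _ (char_mem_kernelInterior hp)]
      ring
  refine ⟨continuousOn_char_of_kernel hW.continuousOn, ?_,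
    fun u v hp => (hasDerivAt_mixed_char hW.contDiffOn hp).1.congr_deriv (heq u v hp),
    fun u v hp => (hasDerivAt_mixed_char hW.contDiffOn hp).2.congr_deriv (heq u v hp),
    fun u hu => ?_, fun v hv => ?_⟩
  · exact (hW.contDiffOn.of_le one_le_two).comp
      (by fun_prop : ContDiffOn ℝ 1 (fun p : ℝ × ℝ => (p.1 + p.2, p.1 - p.2)) _)
      fun _ hp => char_mem_kernelInterior hp
  · simpa using hW.on_diagonal u hu
  · simpa using hW.on_antidiagonal v hv

/-- The C² hypothesis is separate because it is where q ∈ C¹ enters. The equation follows by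
uniqueness of the mixed derivative. -/
theorem SolvesCharGoursat.solvesWaveGoursat
    (hH : SolvesCharGoursat a q h fun u v => K (u + v) (u - v))
    (hC : ContDiffOn ℝ 2 (uncurry fun u v => K (u + v) (u - v)) (charInterior a)) :
    SolvesWaveGoursat a q h K := by
  have hf : ContDiffOn ℝ 2 (uncurry K) (kernelInterior a) := by
    rw [uncurry_eq_char]
    exact hC.comp (by fun_prop) fun p hp => char_mem_charInterior hp
  refine ⟨continuousOn_kernel_of_char hH.continuousOn, hf, fun x t hp => ?_, fun x hx => ?_,
    fun x hx => ?_⟩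
  · have hp' := char_mem_charInterior hp
    have := (hasDerivAt_mixed_char hf hp').1.unique (hH.deriv_u_deriv_v _ _ hp')
    rw [show (x + t) / 2 + (x - t) / 2 = x by ring,
      show (x + t) / 2 - (x - t) / 2 = t by ring] at this
    rw [← this]
    ring
  · simpa using hH.on_u_axis x hx
  · simpa using hH.on_v_axis x hx

/-! ### Equivalences for data given only on the domain -/

theorem eqOn_char (he : EqOn (uncurry K') (uncurry K) (kernelDomain a)) :
    EqOn (uncurry fun u v => K' (u + v) (u - v)) (uncurry fun u v => K (u + v) (u - v))
      (charDomain a) :=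
  fun _ hp => he (char_mem_kernelDomain hp)

theorem mapsSolutions_iff_solvesCharGoursat (ha : 0 < a) (hq : ContinuousOn q (Icc (-a) a)) :
    MapsSolutions a q h K ↔ SolvesCharGoursat a q h fun u v => K (u + v) (u - v) := by
  obtain ⟨q', cq, eq⟩ := exists_continuous_extension_Icc ha.le hq
  constructor
  · intro hM
    obtain ⟨K', cK, eK⟩ := exists_continuous_extension_kernel hM.1
    exact (((hM.congr eq eK).solvesIntegralEquation ha cq cK).solvesCharGoursat cq cK).congr
      eq.symm (eqOn_char eK.symm)
  · intro hH
    obtain ⟨K', cK, eK⟩ := exists_continuous_extension_kernel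
      (continuousOn_kernel_of_char hH.continuousOn)
    exact (((hH.congr eq (eqOn_char eK)).solvesIntegralEquation cq cK).mapsSolutions
      ha.le cq cK).congr eq.symm eK.symm

theorem SolvesCharGoursat.volterraIsTransmutation (hab : -a ≤ a)
    (hq : ContinuousOn q (Icc (-a) a))
    (hH : SolvesCharGoursat a q h fun u v => K (u + v) (u - v)) :
    VolterraIsTransmutation hab q K := by
  obtain ⟨q', cq, eq⟩ := exists_continuous_extension_Icc (by linarith) hq
  obtain ⟨K', cK, eK⟩ := exists_continuous_extension_kernel
    (continuousOn_kernel_of_char hH.continuousOn)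
  exact (((hH.congr eq (eqOn_char eK)).solvesIntegralEquation cq cK).volterraIsTransmutation
    hab cq cK).congr eq.symm eK.symm

theorem SolvesCharGoursat.contDiffOn_two (ha : 0 < a) (hq : ContDiffOn ℝ 1 q (Icc (-a) a))
    (hH : SolvesCharGoursat a q h fun u v => K (u + v) (u - v)) :
    ContDiffOn ℝ 2 (uncurry fun u v => K (u + v) (u - v)) (charInterior a) := by
  obtain ⟨q', cq, eq⟩ := exists_contDiff_extension ha hq
  obtain ⟨K', cK, eK⟩ := exists_continuous_extension_kernel
    (continuousOn_kernel_of_char hH.continuousOn)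
  have hI := (hH.congr eq (eqOn_char eK)).solvesIntegralEquation cq.continuous cK
  refine (hI.contDiffOn_two cq cK).congr fun p hp => ?_
  have hp' := charInterior_subset a hp
  exact (eqOn_char eK hp').symm.trans (hI p.1 p.2 hp')

end Transmutation

end

theorem mainTheorem8 (a : ℝ) (ha : 0 < a) (q : ℝ → ℂ) (hq : ContinuousOn q (Set.Icc (-a) a))
    (h : ℂ) (K : ℝ → ℝ → ℂ) :
    (Transmutation.MapsSolutions a q h K ↔
      Transmutation.SolvesCharGoursat a q h (fun u v => K (u + v) (u - v))) ∧
    ((Transmutation.VolterraIsTransmutation (neg_le_self ha.le) q K ∧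
        Transmutation.MapsSolutions a q h K) ↔
      Transmutation.SolvesCharGoursat a q h (fun u v => K (u + v) (u - v))) ∧
    (ContDiffOn ℝ 1 q (Set.Icc (-a) a) →
      (Transmutation.SolvesCharGoursat a q h (fun u v => K (u + v) (u - v)) ↔
        Transmutation.SolvesWaveGoursat a q h K)) :=
  have key := Transmutation.mapsSolutions_iff_solvesCharGoursat (h := h) (K := K) ha hq
  ⟨key, ⟨fun H => key.1 H.2, fun H => ⟨H.volterraIsTransmutation _ hq, key.2 H⟩⟩,
    fun hq1 => ⟨fun H => H.solvesWaveGoursat (H.contDiffOn_two ha hq1),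
      fun H => H.solvesCharGoursat⟩⟩
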